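/- Let $M$ be a smooth compact manifold without boundary of dimension $n\ge 2$, let $\Phi:U\to\mathbb{R}$ be a smooth function on an open set $U\subset\mathbb{R}$ with $\Phi'>0$, and let $X:M\times[0,T)\to\mathbb{R}^{n+1}$ be smooth, with every $X_t=X(\cdot,t)$ an immersion, with smooth unit normal field $\nu$ (for instance the outer one). Denote by $g_{ij}=\langle\partial_iX,\partial_jX\rangle$ the induced metric, by $h_{ij}=\langle\partial_i\nu,\partial_jX\rangle$ the second fundamental form, by $H=g^{ij}h_{ij}$ the mean curvature, by $|A|^2=g^{ik}g^{jl}h_{ij}h_{kl}$ the squared norm of the second fundamental form, and by $\nabla$ and $\Delta$ the gradient and the Laplace–Beltrami operator of $g$. Suppose that $H$ takes values in $U$ and that $X$ solves $$\partial_tX=-\Phi(H)\,\nu\qquad\text{on } M\times[0,T).$$ Let $\varepsilon\in\mathbb{R}$ be any constant and put $$Z=\frac{\Phi(H)}{\langle X,\nu\rangle-\varepsilon}.$$ Then, at every $(p,t)\in M\times[0,T)$ with $\langle X,\nu\rangle\neq\varepsilon$ and $\Phi(H)\neq0$, the function $Z(\cdot,t)$ is smooth near $p$, $Z(p,\cdot)$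 is differentiable at $t$ (from the right if $t=0$), and $$\partial_tZ=\Phi'\,\Delta Z+\frac{2\Phi'}{\langle X,\nu\rangle-\varepsilon}\,\big\langle\nabla Z,\nabla\langle X,\nu\rangle\big\rangle+Z^2\left[\left(\frac{\Phi'H}{\Phi}+1\right)-\varepsilon\,\frac{\Phi'|A|^2}{\Phi}\right],$$ where $\Phi$ and $\Phi'$ are evaluated at $H$. -/

import Mathlib

open scoped Manifold ContDiff

noncomputable section

namespace PhiFlow

variable {n : ℕ} {M : Type*} [TopologicalSpace M] [ChartedSpace (EuclideanSpace ℝ (Fin n)) M]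

/-- The coordinate derivative `∂ᵢ f` at the point `q`, in the local coordinates given by the
preferred chart at the point `a` (meaningful for `q` in the domain of that chart). -/
def pd {F : Type*} [NormedAddCommGroup F] [NormedSpace ℝ F] (a : M) (i : Fin n) (f : M → F)
    (q : M) : F :=
  fderiv ℝ (f ∘ (chartAt (EuclideanSpace ℝ (Fin n)) a).symm)
    (chartAt (EuclideanSpace ℝ (Fin n)) a q) (EuclideanSpace.single i (1 : ℝ))

/-- The induced metric `g i j = ⟨∂ᵢ X, ∂ⱼ X⟩` at `q`, in the chart at `a`. -/
def metric (X : M → EuclideanSpace ℝ (Fin (n + 1))) (a q : M) : Matrix (Fin n) (Fin n) ℝ :=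
  Matrix.of fun i j => inner ℝ (pd a i X q) (pd a j X q)

/-- The second fundamental form `h i j = ⟨∂ᵢ ν, ∂ⱼ X⟩ = -⟨∂ᵢ ∂ⱼ X, ν⟩` at `q`, in the chart at `a`.
It is positive definite on a round sphere with its outer normal. -/
def secondForm (X ν : M → EuclideanSpace ℝ (Fin (n + 1))) (a q : M) : Matrix (Fin n) (Fin n) ℝ :=
  Matrix.of fun i j => inner ℝ (pd a i ν q) (pd a j X q)

/-- The matrix `g⁻¹ h` of the Weingarten map at `p`, in the chart at `p`. -/
def weingarten (X ν : M → EuclideanSpace ℝ (Fin (n + 1))) (p : M) : Matrix (Fin n) (Fin n) ℝ :=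
  (metric X p p)⁻¹ * secondForm X ν p p

/-- The mean curvature `H`, the trace of the Weingarten map (sum of the principal curvatures). -/
def meanCurvature (X ν : M → EuclideanSpace ℝ (Fin (n + 1))) (p : M) : ℝ :=
  (weingarten X ν p).trace

/-- The total curvature `|A|²`, the trace of the square of the Weingarten map (sum of the squares
of the principal curvatures). -/
def normSqA (X ν : M → EuclideanSpace ℝ (Fin (n + 1))) (p : M) : ℝ :=
  (weingarten X ν p * weingarten X ν p).trace

/-- The Christoffel symbols of the induced metric at `q`, in the chart at `a`:
`Γ k i j = ½ ∑ₗ gᵏˡ (∂ᵢ gⱼₗ + ∂ⱼ gᵢₗ - ∂ₗ gᵢⱼ)`. -/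
def christoffel (X : M → EuclideanSpace ℝ (Fin (n + 1))) (a q : M) (k i j : Fin n) : ℝ :=
  (1 / 2 : ℝ) * ∑ l, (metric X a q)⁻¹ k l *
    (pd a i (fun r => metric X a r j l) q + pd a j (fun r => metric X a r i l) q
      - pd a l (fun r => metric X a r i j) q)

/-- The Laplace-Beltrami operator of the induced metric:
`Δ f = ∑ᵢⱼ gⁱʲ (∂ᵢ ∂ⱼ f - ∑ₖ Γ k i j ∂ₖ f)`. -/
def laplacian (X : M → EuclideanSpace ℝ (Fin (n + 1))) (f : M → ℝ) (p : M) : ℝ :=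
  ∑ i, ∑ j, (metric X p p)⁻¹ i j *
    (pd p i (pd p j f) p - ∑ k, christoffel X p p k i j * pd p k f p)

/-- The inner product `⟨∇ f, ∇ k⟩ = ∑ᵢⱼ gⁱʲ ∂ᵢ f ∂ⱼ k` of the gradients in the induced metric. -/
def gradInner (X : M → EuclideanSpace ℝ (Fin (n + 1))) (f k : M → ℝ) (p : M) : ℝ :=
  ∑ i, ∑ j, (metric X p p)⁻¹ i j * pd p i f p * pd p j k p

/-- The support function `⟨X, ν⟩`. -/
def support (X ν : M → EuclideanSpace ℝ (Fin (n + 1))) (p : M) : ℝ :=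
  inner ℝ (X p) (ν p)

/-- `Z = Φ(H) / (⟨X, ν⟩ - ε)`. -/
def quotZ (Φ : ℝ → ℝ) (ε : ℝ) (X ν : M → EuclideanSpace ℝ (Fin (n + 1))) (p : M) : ℝ :=
  Φ (meanCurvature X ν p) / (support X ν p - ε)

/-- `X t`, `0 ≤ t < T`, is a smooth family of immersions of `M` into `ℝⁿ⁺¹` with smooth unit normal
`ν t`, whose mean curvature takes values in the domain `U` of `Φ`, and which solves
`∂ₜ X = -Φ(H) ν`. -/
structure IsPhiFlow (Φ : ℝ → ℝ) (U : Set ℝ) (T : ℝ)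
    (X ν : ℝ → M → EuclideanSpace ℝ (Fin (n + 1))) : Prop where
  smooth_X : ContMDiffOn (𝓘(ℝ, ℝ).prod (𝓡 n)) 𝓘(ℝ, EuclideanSpace ℝ (Fin (n + 1))) ∞
    (fun z : ℝ × M => X z.1 z.2) (Set.Ico 0 T ×ˢ Set.univ)
  smooth_normal : ContMDiffOn (𝓘(ℝ, ℝ).prod (𝓡 n)) 𝓘(ℝ, EuclideanSpace ℝ (Fin (n + 1))) ∞
    (fun z : ℝ × M => ν z.1 z.2) (Set.Ico 0 T ×ˢ Set.univ)
  immersion : ∀ t ∈ Set.Ico 0 T, ∀ p : M, Function.Injective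
    (mfderiv (𝓡 n) 𝓘(ℝ, EuclideanSpace ℝ (Fin (n + 1))) (X t) p)
  norm_normal : ∀ t ∈ Set.Ico 0 T, ∀ p : M, ‖ν t p‖ = 1
  normal_orthogonal : ∀ t ∈ Set.Ico 0 T, ∀ (p : M) (v : TangentSpace (𝓡 n) p),
    inner ℝ (ν t p) (show EuclideanSpace ℝ (Fin (n + 1)) from
      mfderiv (𝓡 n) 𝓘(ℝ, EuclideanSpace ℝ (Fin (n + 1))) (X t) p v) = 0
  curvature_mem : ∀ t ∈ Set.Ico 0 T, ∀ p : M, meanCurvature (X t) (ν t) p ∈ U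
  evolution : ∀ t ∈ Set.Ico 0 T, ∀ p : M, HasDerivWithinAt (fun s => X s p)
    (-(Φ (meanCurvature (X t) (ν t) p) • ν t p)) (Set.Ico 0 T) t

end PhiFlow

end

/-! ### Linear algebra: inner products in a moving frame and derivatives of inverse matrices. -/

namespace PhiFlow

variable {n : ℕ}

/-! Write F = Φ(H) and S = ⟨X, ν⟩, and let X^T be the tangential part of X. Three identities carry
the proof: ∂ₜH = ΔF + F|A|² and ∂ₜS = -F + ⟨X^T, ∇F⟩ (`hasDerivWithinAt_meanAt_and_support`), and ΔS
= ⟨X^T, ∇H⟩ + H - |A|²S (`laplaceAt_support`). The first two follow by differentiating the metric,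
the second form and the normal in time, with ∂ₜν = ∇F. The third is Δν = ∇H - |A|²ν, whose
tangential part is Codazzi.

Since F = Z(S - ε), the product rule `laplaceAt_mul` gives ΔF = (S - ε)ΔZ + ZΔS + 2⟨∇Z, ∇S⟩.
Inserted into the quotient rule for ∂ₜZ, the two transport terms along X^T cancel because ∇F = Φ'∇H,
and the |A|² terms combine to Φ'Z|A|²(1 - S/(S - ε)) = -εΦ'Z|A|²/(S - ε).

All this is done for a parametrized hypersurface over an open subset of ℝⁿ. To return to M, the mean
curvature near p, defined at each point in that point's own chart, must agree with its expression in
the single chart at p (`meanAt_inChart`). -/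

theorem inner_eq_sum_frame (e : Fin n → EuclideanSpace ℝ (Fin (n + 1)))
    (ν : EuclideanSpace ℝ (Fin (n + 1))) (he : LinearIndependent ℝ e) (hν : ‖ν‖ = 1)
    (horth : ∀ i, inner ℝ ν (e i) = 0) (v w : EuclideanSpace ℝ (Fin (n + 1))) :
    inner ℝ v w = ∑ k, ∑ l, (Matrix.gram ℝ e)⁻¹ k l * inner ℝ v (e k) * inner ℝ (e l) w
      + inner ℝ v ν * inner ℝ ν w := by
  set G := Matrix.gram ℝ e with hG
  have hdet : IsUnit G.det := by
    have := (Matrix.posDef_gram_of_linearIndependent (𝕜 := ℝ) he).det_pos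
    exact isUnit_iff_ne_zero.mpr this.ne'
  have hνν : inner ℝ ν ν = 1 := by rw [real_inner_self_eq_norm_sq, hν]; norm_num
  set r := w - ∑ k, ∑ l, (G⁻¹ k l * inner ℝ (e l) w) • e k - (inner ℝ ν w : ℝ) • ν with hr
  have hrν : inner ℝ ν r = 0 := by
    simp [hr, inner_sub_right, inner_sum, inner_smul_right, horth, hν]
  have hre : ∀ m, inner ℝ (e m) r = 0 := by
    intro m
    have h1 : ∀ k, inner ℝ (e m) (e k) = G m k := fun k => rfl
    have h2 : ∑ k, ∑ l, G⁻¹ k l * inner ℝ (e l) w * G m k = inner ℝ (e m) w := by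
      rw [Finset.sum_comm]
      have : ∀ l, ∑ k, G⁻¹ k l * inner ℝ (e l) w * G m k = (G * G⁻¹) m l * inner ℝ (e l) w := by
        intro l
        rw [Matrix.mul_apply, Finset.sum_mul]
        exact Finset.sum_congr rfl fun k _ => by ring
      simp [this, Matrix.mul_nonsing_inv _ hdet, Matrix.one_apply]
    have h3 : inner ℝ (e m) ν = 0 := by rw [real_inner_comm]; exact horth m
    simp only [hr, inner_sub_right, inner_sum, inner_smul_right, h1, h2, h3]
    ring
  -- The frame together with ν consists of n + 1 independent vectors, hence spans; the remainder r
  -- is orthogonal to all of them.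
  have hr0 : r = 0 := by
    let b : Option (Fin n) → EuclideanSpace ℝ (Fin (n + 1)) := fun o => o.casesOn' ν e
    have hb : LinearIndependent ℝ b := by
      rw [linearIndependent_option']
      refine ⟨he, fun hmem => ?_⟩
      have : inner ℝ ν ν = 0 := by
        refine Submodule.span_induction (p := fun z _ => inner ℝ ν z = 0) ?_ ?_ ?_ ?_ hmem
        · rintro _ ⟨i, rfl⟩; exact horth i
        · simp
        · intro a c _ _ ha hc; rw [inner_add_right, ha, hc, add_zero]
        · intro a c _ hc; rw [inner_smul_right, hc, mul_zero]
      rw [hνν] at this; exact one_ne_zero this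
    have hs : Submodule.span ℝ (Set.range b) = ⊤ :=
      hb.span_eq_top_of_card_eq_finrank' (by simp)
    have : inner ℝ r r = 0 := by
      have hmem : r ∈ Submodule.span ℝ (Set.range b) := hs ▸ Submodule.mem_top
      refine Submodule.span_induction (p := fun z _ => inner ℝ z r = 0) ?_ ?_ ?_ ?_ hmem
      · rintro _ ⟨i, rfl⟩
        cases i with
        | none => exact hrν
        | some i => exact hre i
      · simp
      · intro a c _ _ ha hc; rw [inner_add_left, ha, hc, add_zero]
      · intro a c _ hc; rw [inner_smul_left, hc, mul_zero]
    exact inner_self_eq_zero.mp this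
  have hw : w = ∑ k, ∑ l, (G⁻¹ k l * inner ℝ (e l) w) • e k + (inner ℝ ν w : ℝ) • ν := by
    rw [hr, sub_sub, sub_eq_zero] at hr0; exact hr0
  conv_lhs => rw [hw]
  simp only [inner_add_right, inner_sum, inner_smul_right]
  congr 1
  · exact Finset.sum_congr rfl fun k _ => Finset.sum_congr rfl fun l _ => by ring
  · ring

section matrix
variable {m : Type*} [Fintype m] [DecidableEq m]

/-- Cramer's rule: the inverse is the adjugate over the determinant, and entries of the adjugate are
again determinants, so everything is polynomial in the entries except one division. -/
theorem contDiffAt_matrix_inv {E : Type*} [NormedAddCommGroup E] [NormedSpace ℝ E]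
    {G : E → Matrix m m ℝ} {y : E} {k : WithTop ℕ∞} (hG : ∀ i j, ContDiffAt ℝ k (fun z => G z i j) y)
    (hdet : (G y).det ≠ 0) (i j : m) : ContDiffAt ℝ k (fun z => (G z)⁻¹ i j) y := by
  have hD : ∀ A : E → Matrix m m ℝ, (∀ i j, ContDiffAt ℝ k (fun z => A z i j) y) →
      ContDiffAt ℝ k (fun z => (A z).det) y := by
    intro A hA
    simp only [Matrix.det_apply']
    exact ContDiffAt.sum fun σ _ => contDiffAt_const.mul (contDiffAt_prod fun i _ => hA _ _)
  have h1 : (fun z => (G z)⁻¹ i j) = fun z => ((G z).det)⁻¹ * (G z).adjugate i j := by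
    ext z
    rw [Matrix.inv_def, Matrix.smul_apply, Ring.inverse_eq_inv', smul_eq_mul]
  rw [h1]
  refine ((hD G hG).inv hdet).mul ?_
  simp only [Matrix.adjugate_apply]
  refine hD _ fun a b => ?_
  by_cases h : a = j
  · subst h; simpa using contDiffAt_const
  · simpa [Matrix.updateRow_ne h] using hG a b

theorem hasDerivWithinAt_matrix_inv {G : ℝ → Matrix m m ℝ} {G' : Matrix m m ℝ} {s : Set ℝ} {t : ℝ}
    (hG : ∀ i j, HasDerivWithinAt (fun r => G r i j) (G' i j) s t) (hdet : (G t).det ≠ 0)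
    (i j : m) : HasDerivWithinAt (fun r => (G r)⁻¹ i j) ((-((G t)⁻¹ * G' * (G t)⁻¹)) i j) s t := by
  -- A local choice of norm makes the matrices a Banach algebra, where the derivative of inversion
  -- is known; derivatives are still read off entrywise.
  let _ := Matrix.linftyOpNormedRing (n := m) (α := ℝ)
  let _ := Matrix.linftyOpNormedAlgebra (n := m) (R := ℝ) (α := ℝ)
  have hG1 : HasDerivWithinAt G G' s t :=
    hasDerivWithinAt_pi.2 fun i => hasDerivWithinAt_pi.2 fun j => hG i j
  have hu : IsUnit (G t) := (Matrix.isUnit_iff_isUnit_det _).2 (isUnit_iff_ne_zero.2 hdet)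
  obtain ⟨u, hu⟩ := hu
  have h2 := (hu ▸ hasFDerivAt_ringInverse (𝕜 := ℝ) u :
    HasFDerivAt Ring.inverse _ (G t)).comp_hasDerivWithinAt t hG1
  have h3 := hasDerivWithinAt_pi.1 (hasDerivWithinAt_pi.1 h2 i) j
  have h4 : (fun r => (G r)⁻¹ i j) = fun r => (Ring.inverse ∘ G) r i j := by
    ext r; simp [Matrix.nonsing_inv_eq_ringInverse]
  rw [h4]
  have h5 : (↑u⁻¹ : Matrix m m ℝ) = (G t)⁻¹ := by rw [Matrix.coe_units_inv, hu]
  have h6 : (-ContinuousLinearMap.mulLeftRight ℝ (Matrix m m ℝ) (↑u⁻¹ : Matrix m m ℝ)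
      (↑u⁻¹ : Matrix m m ℝ)) G' = -((G t)⁻¹ * G' * (G t)⁻¹) := by
    rw [h5]; simp
  exact h3.congr_deriv (congrFun (congrFun h6 i) j)

/-- Serves for H = tr(g⁻¹h) twice: along the flow, on a half-open time interval, and along a
coordinate line in space. -/
theorem hasDerivWithinAt_trace_inv_mul {G h : ℝ → Matrix m m ℝ} {G' h' : Matrix m m ℝ} {s : Set ℝ}
    {t : ℝ} (hG : ∀ i j, HasDerivWithinAt (fun r => G r i j) (G' i j) s t)
    (hh : ∀ i j, HasDerivWithinAt (fun r => h r i j) (h' i j) s t) (hdet : (G t).det ≠ 0) :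
    HasDerivWithinAt (fun r => ((G r)⁻¹ * h r).trace)
      (((G t)⁻¹ * h').trace - ((G t)⁻¹ * G' * (G t)⁻¹ * h t).trace) s t := by
  have h1 : HasDerivWithinAt (fun r => ∑ i, ∑ j, (G r)⁻¹ i j * h r j i)
      (∑ i, ∑ j, ((-((G t)⁻¹ * G' * (G t)⁻¹)) i j * h t j i + (G t)⁻¹ i j * h' j i)) s t :=
    HasDerivWithinAt.fun_sum fun i _ => HasDerivWithinAt.fun_sum fun j _ =>
      (hasDerivWithinAt_matrix_inv hG hdet i j).mul (hh j i)
  have htr (A B : Matrix m m ℝ) : (A * B).trace = ∑ i, ∑ j, A i j * B j i := by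
    simp [Matrix.trace, Matrix.mul_apply]
  have h2 : ((G t)⁻¹ * h').trace - ((G t)⁻¹ * G' * (G t)⁻¹ * h t).trace =
      (-((G t)⁻¹ * G' * (G t)⁻¹) * h t).trace + ((G t)⁻¹ * h').trace := by
    rw [Matrix.neg_mul, Matrix.trace_neg]; ring
  rw [h2]
  simpa only [htr, Finset.sum_add_distrib] using h1
end matrix

end PhiFlow

/-! ### Calculus: time derivatives up to the initial time, partial derivatives in space. -/

namespace PhiFlow

theorem two_le_infty : (2 : WithTop ℕ∞) ≤ ∞ := by
  exact WithTop.coe_le_coe.2 (le_top : (2 : ℕ∞) ≤ ⊤)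

section time
variable {E W : Type*} [NormedAddCommGroup E] [NormedSpace ℝ E] [NormedAddCommGroup W]
  [NormedSpace ℝ W]

/-- For a map that is smooth up to the initial time, the time derivative is smooth in space, and
time and space derivatives commute. -/
theorem exists_time_derivative {T : ℝ} {V : Set E} (hV : IsOpen V) {f : ℝ → E → W}
    (hf : ContDiffOn ℝ ∞ (fun z : ℝ × E => f z.1 z.2) (Set.Ico 0 T ×ˢ V)) {t : ℝ}
    (ht : t ∈ Set.Ico 0 T) :
    ∃ f' : E → W, ContDiffOn ℝ ∞ f' V ∧
      (∀ y ∈ V, HasDerivWithinAt (fun s => f s y) (f' y) (Set.Ico 0 T) t) ∧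
      ∀ y ∈ V, ∀ v, HasDerivWithinAt (fun s => fderiv ℝ (f s) y v) (fderiv ℝ f' y v)
        (Set.Ico 0 T) t := by
  set S : Set (ℝ × E) := Set.Ico 0 T ×ˢ V with hS
  set g : ℝ × E → W := fun z => f z.1 z.2 with hg
  have hSu : UniqueDiffOn ℝ S := (uniqueDiffOn_Ico 0 T).prod hV.uniqueDiffOn
  set D : ℝ × E → (ℝ × E →L[ℝ] W) := fderivWithin ℝ g S with hD
  have hDs : ContDiffOn ℝ ∞ D S := hf.fderivWithin hSu (by simp)
  have hgd : ∀ z ∈ S, HasFDerivWithinAt g (D z) S z := fun z hz =>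
    ((hf.differentiableOn (by simp)) z hz).hasFDerivWithinAt
  -- At fixed time the slice is open, so a genuine derivative in space results; at a fixed point
  -- only a derivative within the time interval does.
  have hslice : ∀ {s}, s ∈ Set.Ico 0 T → ∀ {y}, y ∈ V → ∀ {k : ℝ × E → W} {k' : ℝ × E →L[ℝ] W},
      HasFDerivWithinAt k k' S (s, y) →
      HasFDerivAt (fun y => k (s, y)) (k'.comp (ContinuousLinearMap.inr ℝ ℝ E)) y := by
    intro s hs y hy k k' hk
    have h1 : HasFDerivWithinAt (fun y : E => (s, y)) (ContinuousLinearMap.inr ℝ ℝ E) V y :=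
      (hasFDerivAt_prodMk_right s y).hasFDerivWithinAt
    exact (hk.comp y h1 fun z hz => (⟨hs, hz⟩ : (s, z) ∈ S)).hasFDerivAt (hV.mem_nhds hy)
  have htime : ∀ {s}, s ∈ Set.Ico 0 T → ∀ {y}, y ∈ V → ∀ {k : ℝ × E → W} {k' : ℝ × E →L[ℝ] W},
      HasFDerivWithinAt k k' S (s, y) →
      HasDerivWithinAt (fun r => k (r, y)) (k' (1, 0)) (Set.Ico 0 T) s := by
    intro s hs y hy k k' hk
    have h1 : HasDerivWithinAt (fun r : ℝ => (r, y)) ((1 : ℝ), (0 : E)) (Set.Ico 0 T) s :=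
      (hasDerivAt_id s).hasDerivWithinAt.prodMk (hasDerivWithinAt_const _ _ _)
    exact hk.comp_hasDerivWithinAt s h1 fun r hr => (⟨hr, hy⟩ : (r, y) ∈ S)
  refine ⟨fun y => D (t, y) (1, 0), ?_, fun y hy => htime ht hy (hgd _ ⟨ht, hy⟩), ?_⟩
  · have : ContDiffOn ℝ ∞ (fun y => D (t, y)) V :=
      hDs.comp (contDiff_prodMk_right t).contDiffOn fun y hy => ⟨ht, hy⟩
    exact this.clm_apply contDiffOn_const
  · intro y hy v
    have hz : (t, y) ∈ S := ⟨ht, hy⟩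
    have hDd : HasFDerivWithinAt D (fderivWithin ℝ D S (t, y)) S (t, y) :=
      ((hDs.differentiableOn (by simp)) _ hz).hasFDerivWithinAt
    -- Symmetry of the second derivative persists at t = 0, because every point of S lies in the
    -- closure of its interior.
    have hsymm : IsSymmSndFDerivWithinAt ℝ g S (t, y) := by
      refine (hf _ hz).isSymmSndFDerivWithinAt (by simpa using two_le_infty) hSu ?_ hz
      rw [hS, interior_prod_eq, closure_prod_eq, interior_Ico, hV.interior_eq,
        closure_Ioo (ne_of_lt (lt_of_le_of_lt ht.1 ht.2))]
      exact ⟨⟨ht.1, ht.2.le⟩, subset_closure hy⟩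
    have h1 : HasDerivWithinAt (fun s => D (s, y) (0, v))
        (fderivWithin ℝ D S (t, y) (1, 0) (0, v)) (Set.Ico 0 T) t :=
      htime ht hy (k := fun z => D z (0, v))
        (k' := (ContinuousLinearMap.apply ℝ W ((0, v) : ℝ × E)).comp _)
        ((ContinuousLinearMap.apply ℝ W ((0, v) : ℝ × E)).hasFDerivAt.comp_hasFDerivWithinAt _ hDd)
    have h2 := (hslice ht hy (k := fun z => D z (1, 0))
        (k' := (ContinuousLinearMap.apply ℝ W ((1, 0) : ℝ × E)).comp _)
        ((ContinuousLinearMap.apply ℝ W ((1, 0) : ℝ × E)).hasFDerivAt.comp_hasFDerivWithinAt _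
          hDd)).fderiv
    rw [h2]
    have h3 : ∀ s ∈ Set.Ico 0 T, fderiv ℝ (f s) y v = D (s, y) (0, v) := fun s hs => by
      have := (hslice hs hy (hgd (s, y) ⟨hs, hy⟩)).fderiv
      simp only [hg] at this
      rw [this]; simp
    refine (h1.congr h3 (h3 t ht)).congr_deriv ?_
    simpa using hsymm (1, 0) (0, v)

end time

section space
variable {n : ℕ} {F : Type*} [NormedAddCommGroup F] [NormedSpace ℝ F]

/-- The partial derivative `∂ᵢ f` on `ℝⁿ`. -/
noncomputable def partialDeriv (i : Fin n) (f : EuclideanSpace ℝ (Fin n) → F)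
    (y : EuclideanSpace ℝ (Fin n)) : F :=
  fderiv ℝ f y (EuclideanSpace.single i (1 : ℝ))

variable {V : Set (EuclideanSpace ℝ (Fin n))} {y : EuclideanSpace ℝ (Fin n)}

theorem _root_.ContDiffOn.differentiableAt_of_isOpen {f : EuclideanSpace ℝ (Fin n) → F}
    (hf : ContDiffOn ℝ ∞ f V) (hV : IsOpen V) (hy : y ∈ V) : DifferentiableAt ℝ f y :=
  (hf.contDiffAt (hV.mem_nhds hy)).differentiableAt (by simp)

theorem contDiffOn_partialDeriv {f : EuclideanSpace ℝ (Fin n) → F} (hf : ContDiffOn ℝ ∞ f V)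
    (hV : IsOpen V) (i : Fin n) : ContDiffOn ℝ ∞ (partialDeriv i f) V :=
  (hf.fderiv_of_isOpen hV (by simp)).clm_apply contDiffOn_const

theorem partialDeriv_congr {f g : EuclideanSpace ℝ (Fin n) → F} (hV : IsOpen V)
    (h : ∀ z ∈ V, f z = g z) (hy : y ∈ V) (i : Fin n) : partialDeriv i f y = partialDeriv i g y := by
  have : f =ᶠ[nhds y] g := Filter.eventually_of_mem (hV.mem_nhds hy) h
  rw [partialDeriv, this.fderiv_eq, partialDeriv]

theorem partialDeriv_comm {f : EuclideanSpace ℝ (Fin n) → F} (hf : ContDiffOn ℝ ∞ f V)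
    (hV : IsOpen V) (hy : y ∈ V) (i j : Fin n) :
    partialDeriv i (partialDeriv j f) y = partialDeriv j (partialDeriv i f) y := by
  have hd : DifferentiableAt ℝ (fderiv ℝ f) y :=
    (hf.fderiv_of_isOpen (m := ∞) hV (by simp)).differentiableAt_of_isOpen hV hy
  have h : ∀ a b : Fin n, partialDeriv a (partialDeriv b f) y =
      fderiv ℝ (fderiv ℝ f) y (EuclideanSpace.single a 1) (EuclideanSpace.single b 1) := by
    intro a b
    have := fderiv_clm_apply hd (differentiableAt_const (EuclideanSpace.single b (1 : ℝ)))
    change fderiv ℝ (fun z => fderiv ℝ f z (EuclideanSpace.single b 1)) y _ = _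
    rw [this]; simp
  rw [h, h]
  exact ((hf.contDiffAt (hV.mem_nhds hy)).isSymmSndFDerivAt (by simpa using two_le_infty)) _ _

theorem partialDeriv_inner {W : Type*} [NormedAddCommGroup W] [InnerProductSpace ℝ W]
    {f g : EuclideanSpace ℝ (Fin n) → W} (hf : DifferentiableAt ℝ f y)
    (hg : DifferentiableAt ℝ g y) (i : Fin n) :
    partialDeriv i (fun z => (inner ℝ (f z) (g z) : ℝ)) y =
      inner ℝ (f y) (partialDeriv i g y) + inner ℝ (partialDeriv i f y) (g y) :=
  fderiv_inner_apply ℝ hf hg _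

theorem partialDeriv_smul {c : EuclideanSpace ℝ (Fin n) → ℝ} {f : EuclideanSpace ℝ (Fin n) → F}
    (hc : DifferentiableAt ℝ c y) (hf : DifferentiableAt ℝ f y) (i : Fin n) :
    partialDeriv i (fun z => c z • f z) y = c y • partialDeriv i f y + partialDeriv i c y • f y := by
  simp [partialDeriv, fderiv_fun_smul hc hf]

theorem partialDeriv_mul {c f : EuclideanSpace ℝ (Fin n) → ℝ}
    (hc : DifferentiableAt ℝ c y) (hf : DifferentiableAt ℝ f y) (i : Fin n) :
    partialDeriv i (fun z => c z * f z) y = c y * partialDeriv i f y + partialDeriv i c y * f y :=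
  partialDeriv_smul hc hf i

theorem partialDeriv_add {f g : EuclideanSpace ℝ (Fin n) → F}
    (hf : DifferentiableAt ℝ f y) (hg : DifferentiableAt ℝ g y) (i : Fin n) :
    partialDeriv i (fun z => f z + g z) y = partialDeriv i f y + partialDeriv i g y := by
  simp [partialDeriv, fderiv_fun_add hf hg]

theorem partialDeriv_const (c : F) (i : Fin n) :
    partialDeriv i (fun _ => c) y = 0 := by
  simp [partialDeriv]

/-- Turns a partial derivative into a one-variable derivative, the form required by
`hasDerivWithinAt_trace_inv_mul`. -/
theorem hasDerivAt_comp_line {f : EuclideanSpace ℝ (Fin n) → F} (hf : DifferentiableAt ℝ f y)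
    (i : Fin n) : HasDerivAt (fun s : ℝ => f (y + s • EuclideanSpace.single i (1 : ℝ)))
      (partialDeriv i f y) 0 :=
  hf.hasFDerivAt.hasLineDerivAt (EuclideanSpace.single i (1 : ℝ))

end space

end PhiFlow

/-! ### Local geometry of a parametrized hypersurface. -/

namespace PhiFlow

variable {n : ℕ}

/-- The Gram matrix of the coordinate frame `∂ᵢ x`. -/
noncomputable def gramAt (x : EuclideanSpace ℝ (Fin n) → EuclideanSpace ℝ (Fin (n + 1)))
    (y : EuclideanSpace ℝ (Fin n)) : Matrix (Fin n) (Fin n) ℝ :=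
  Matrix.gram ℝ fun i => partialDeriv i x y

/-- The matrix `⟨∂ᵢ N, ∂ⱼ x⟩`. -/
noncomputable def secondAt (x N : EuclideanSpace ℝ (Fin n) → EuclideanSpace ℝ (Fin (n + 1)))
    (y : EuclideanSpace ℝ (Fin n)) : Matrix (Fin n) (Fin n) ℝ :=
  Matrix.of fun i j => inner ℝ (partialDeriv i N y) (partialDeriv j x y)

/-- The mean curvature of a parametrized hypersurface. -/
noncomputable def meanAt (x N : EuclideanSpace ℝ (Fin n) → EuclideanSpace ℝ (Fin (n + 1)))
    (y : EuclideanSpace ℝ (Fin n)) : ℝ :=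
  ((gramAt x y)⁻¹ * secondAt x N y).trace

/-- The squared norm of the second fundamental form of a parametrized hypersurface. -/
noncomputable def normSqAt (x N : EuclideanSpace ℝ (Fin n) → EuclideanSpace ℝ (Fin (n + 1)))
    (y : EuclideanSpace ℝ (Fin n)) : ℝ :=
  ((gramAt x y)⁻¹ * secondAt x N y * ((gramAt x y)⁻¹ * secondAt x N y)).trace

/-- The Christoffel symbols, as tangential components of `∂ᵢ ∂ⱼ x`. -/
noncomputable def gammaAt (x : EuclideanSpace ℝ (Fin n) → EuclideanSpace ℝ (Fin (n + 1)))
    (y : EuclideanSpace ℝ (Fin n)) (k i j : Fin n) : ℝ :=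
  ∑ l, (gramAt x y)⁻¹ k l * inner ℝ (partialDeriv l x y) (partialDeriv i (partialDeriv j x) y)

/-- The Hessian of `f` with respect to the induced metric. -/
noncomputable def hessAt (x : EuclideanSpace ℝ (Fin n) → EuclideanSpace ℝ (Fin (n + 1)))
    (f : EuclideanSpace ℝ (Fin n) → ℝ) (y : EuclideanSpace ℝ (Fin n)) (i j : Fin n) : ℝ :=
  partialDeriv i (partialDeriv j f) y - ∑ k, gammaAt x y k i j * partialDeriv k f y

/-- The Laplace-Beltrami operator of the induced metric. -/
noncomputable def laplaceAt (x : EuclideanSpace ℝ (Fin n) → EuclideanSpace ℝ (Fin (n + 1)))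
    (f : EuclideanSpace ℝ (Fin n) → ℝ) (y : EuclideanSpace ℝ (Fin n)) : ℝ :=
  ∑ i, ∑ j, (gramAt x y)⁻¹ i j * hessAt x f y i j

/-- The inner product of two gradients in the induced metric. -/
noncomputable def gradInnerAt (x : EuclideanSpace ℝ (Fin n) → EuclideanSpace ℝ (Fin (n + 1)))
    (f k : EuclideanSpace ℝ (Fin n) → ℝ) (y : EuclideanSpace ℝ (Fin n)) : ℝ :=
  ∑ i, ∑ j, (gramAt x y)⁻¹ i j * partialDeriv i f y * partialDeriv j k y

/-- `x` is a smooth immersion of the open set `V` with smooth unit normal `N`. -/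
structure IsHypersurface (V : Set (EuclideanSpace ℝ (Fin n)))
    (x N : EuclideanSpace ℝ (Fin n) → EuclideanSpace ℝ (Fin (n + 1))) : Prop where
  isOpen : IsOpen V
  smooth : ContDiffOn ℝ ∞ x V
  smooth_normal : ContDiffOn ℝ ∞ N V
  linearIndependent : ∀ y ∈ V, LinearIndependent ℝ fun i => partialDeriv i x y
  norm_normal : ∀ y ∈ V, ‖N y‖ = 1
  orthogonal : ∀ y ∈ V, ∀ i, inner ℝ (N y) (partialDeriv i x y) = 0

theorem trace_mul_eq_sum {m : Type*} [Fintype m] (A B : Matrix m m ℝ) :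
    (A * B).trace = ∑ i, ∑ j, A i j * B j i := by
  simp [Matrix.trace, Matrix.mul_apply]

namespace IsHypersurface

variable {V : Set (EuclideanSpace ℝ (Fin n))}
  {x N : EuclideanSpace ℝ (Fin n) → EuclideanSpace ℝ (Fin (n + 1))}
  {y : EuclideanSpace ℝ (Fin n)}

theorem det_ne_zero (hx : IsHypersurface V x N) (hy : y ∈ V) : (gramAt x y).det ≠ 0 :=
  (Matrix.posDef_gram_of_linearIndependent (𝕜 := ℝ) (hx.linearIndependent y hy)).det_pos.ne'

theorem _root_.PhiFlow.gramAt_transpose : (gramAt x y).transpose = gramAt x y := by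
  ext i j
  exact real_inner_comm (partialDeriv i x y) (partialDeriv j x y)

theorem _root_.PhiFlow.gramAt_inv_transpose :
    ((gramAt x y)⁻¹).transpose = (gramAt x y)⁻¹ := by
  rw [Matrix.transpose_nonsing_inv, gramAt_transpose]

theorem _root_.PhiFlow.gramAt_inv_symm (i j : Fin n) :
    (gramAt x y)⁻¹ i j = (gramAt x y)⁻¹ j i :=
  congrFun (congrFun (gramAt_inv_transpose (x := x) (y := y)) j) i

theorem inner_eq_sum (hx : IsHypersurface V x N) (hy : y ∈ V)
    (v w : EuclideanSpace ℝ (Fin (n + 1))) :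
    inner ℝ v w = ∑ k, ∑ l, (gramAt x y)⁻¹ k l * inner ℝ v (partialDeriv k x y) *
      inner ℝ (partialDeriv l x y) w + inner ℝ v (N y) * inner ℝ (N y) w :=
  inner_eq_sum_frame _ _ (hx.linearIndependent y hy) (hx.norm_normal y hy) (hx.orthogonal y hy) v w

theorem inner_eq_sum_of_orthogonal (hx : IsHypersurface V x N) (hy : y ∈ V)
    {v w : EuclideanSpace ℝ (Fin (n + 1))} (h : inner ℝ (N y) w = 0) :
    inner ℝ v w = ∑ k, ∑ l, (gramAt x y)⁻¹ k l * inner ℝ v (partialDeriv k x y) *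
      inner ℝ (partialDeriv l x y) w := by
  rw [hx.inner_eq_sum hy, h, mul_zero, add_zero]

theorem diff (hx : IsHypersurface V x N) (hy : y ∈ V) : DifferentiableAt ℝ x y :=
  hx.smooth.differentiableAt_of_isOpen hx.isOpen hy

theorem diff_normal (hx : IsHypersurface V x N) (hy : y ∈ V) : DifferentiableAt ℝ N y :=
  hx.smooth_normal.differentiableAt_of_isOpen hx.isOpen hy

theorem diff_partial (hx : IsHypersurface V x N) (hy : y ∈ V) (i : Fin n) :
    DifferentiableAt ℝ (partialDeriv i x) y :=
  (contDiffOn_partialDeriv hx.smooth hx.isOpen i).differentiableAt_of_isOpen hx.isOpen hy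

theorem diff_partial_normal (hx : IsHypersurface V x N) (hy : y ∈ V) (i : Fin n) :
    DifferentiableAt ℝ (partialDeriv i N) y :=
  (contDiffOn_partialDeriv hx.smooth_normal hx.isOpen i).differentiableAt_of_isOpen hx.isOpen hy

theorem inner_normal_partial_normal (hx : IsHypersurface V x N) (hy : y ∈ V) (i : Fin n) :
    inner ℝ (N y) (partialDeriv i N y) = 0 := by
  have h1 : partialDeriv i (fun z => (inner ℝ (N z) (N z) : ℝ)) y = 0 := by
    rw [partialDeriv_congr hx.isOpen (g := fun _ => (1 : ℝ)) ?_ hy, partialDeriv_const]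
    intro z hz
    rw [real_inner_self_eq_norm_sq, hx.norm_normal z hz, one_pow]
  rw [partialDeriv_inner (hx.diff_normal hy) (hx.diff_normal hy),
    real_inner_comm (N y) (partialDeriv i N y)] at h1
  linarith [real_inner_comm (N y) (partialDeriv i N y)]

/-- Differentiate ⟨N, ∂ⱼx⟩ = 0. Symmetry of h then follows from commuting partial derivatives of x.
-/
theorem secondAt_eq (hx : IsHypersurface V x N) (hy : y ∈ V) (i j : Fin n) :
    inner ℝ (partialDeriv i N y) (partialDeriv j x y) =
      -inner ℝ (N y) (partialDeriv i (partialDeriv j x) y) := by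
  have h1 : partialDeriv i (fun z => (inner ℝ (N z) (partialDeriv j x z) : ℝ)) y = 0 := by
    rw [partialDeriv_congr hx.isOpen (g := fun _ => (0 : ℝ)) ?_ hy, partialDeriv_const]
    exact fun z hz => hx.orthogonal z hz j
  rw [partialDeriv_inner (hx.diff_normal hy) (hx.diff_partial hy j)] at h1
  linarith

theorem secondAt_symm (hx : IsHypersurface V x N) (hy : y ∈ V) (i j : Fin n) :
    (inner ℝ (partialDeriv i N y) (partialDeriv j x y) : ℝ) =
      inner ℝ (partialDeriv j N y) (partialDeriv i x y) := by
  rw [hx.secondAt_eq hy, hx.secondAt_eq hy, partialDeriv_comm hx.smooth hx.isOpen hy]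

theorem secondAt_transpose (hx : IsHypersurface V x N) (hy : y ∈ V) :
    (secondAt x N y).transpose = secondAt x N y := by
  ext i j
  exact hx.secondAt_symm hy j i

theorem inner_normal_partial_partial_normal (hx : IsHypersurface V x N) (hy : y ∈ V)
    (i j : Fin n) : inner ℝ (N y) (partialDeriv i (partialDeriv j N) y) =
      -inner ℝ (partialDeriv i N y) (partialDeriv j N y) := by
  have h1 : partialDeriv i (fun z => (inner ℝ (N z) (partialDeriv j N z) : ℝ)) y = 0 := by
    rw [partialDeriv_congr hx.isOpen (g := fun _ => (0 : ℝ)) ?_ hy, partialDeriv_const]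
    exact fun z hz => hx.inner_normal_partial_normal hz j
  rw [partialDeriv_inner (hx.diff_normal hy) (hx.diff_partial_normal hy j)] at h1
  linarith

/-- A tangent vector v sees only the tangential part of ∂ᵢ∂ⱼx, whose coefficients are the
Christoffel symbols. This removes Christoffel symbols from all later computations. -/
theorem sum_gammaAt_mul_inner (hx : IsHypersurface V x N) (hy : y ∈ V)
    {v : EuclideanSpace ℝ (Fin (n + 1))} (hv : inner ℝ (N y) v = 0) (i j : Fin n) :
    ∑ k, gammaAt x y k i j * inner ℝ v (partialDeriv k x y) =
      inner ℝ v (partialDeriv i (partialDeriv j x) y) := by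
  rw [hx.inner_eq_sum hy v, real_inner_comm (N y) v, hv, zero_mul, add_zero]
  refine Finset.sum_congr rfl fun k _ => ?_
  rw [gammaAt, Finset.sum_mul]
  exact Finset.sum_congr rfl fun l _ => by ring

theorem contDiffAt_meanAt (hx : IsHypersurface V x N) (hy : y ∈ V) :
    ContDiffAt ℝ ∞ (meanAt x N) y := by
  have hV := hx.isOpen.mem_nhds hy
  have hp : ∀ i, ContDiffAt ℝ ∞ (partialDeriv i x) y := fun i =>
    (contDiffOn_partialDeriv hx.smooth hx.isOpen i).contDiffAt hV
  have hq : ∀ i, ContDiffAt ℝ ∞ (partialDeriv i N) y := fun i =>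
    (contDiffOn_partialDeriv hx.smooth_normal hx.isOpen i).contDiffAt hV
  have h1 : meanAt x N = fun z => ∑ i, ∑ j, (gramAt x z)⁻¹ i j * secondAt x N z j i := by
    ext z; exact trace_mul_eq_sum _ _
  rw [h1]
  refine ContDiffAt.sum fun i _ => ContDiffAt.sum fun j _ => ContDiffAt.mul ?_ ?_
  · exact contDiffAt_matrix_inv (fun a b => (hp a).inner ℝ (hp b)) (hx.det_ne_zero hy) i j
  · exact (hq j).inner ℝ (hp i)

/-- The right side is the trace of ∇ₗh. The derivative of h contributes tr(GA) + tr(GC), that of the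
inverse metric contributes -2 tr(GC). -/
theorem partialDeriv_meanAt (hx : IsHypersurface V x N) (hy : y ∈ V) (l : Fin n) :
    partialDeriv l (meanAt x N) y = ∑ i, ∑ j, (gramAt x y)⁻¹ i j *
      (inner ℝ (partialDeriv l (partialDeriv i N) y) (partialDeriv j x y) -
        inner ℝ (partialDeriv j N y) (partialDeriv l (partialDeriv i x) y)) := by
  set G := (gramAt x y)⁻¹ with hG
  set h := secondAt x N y with hh
  let A : Matrix (Fin n) (Fin n) ℝ := Matrix.of fun i j =>
    inner ℝ (partialDeriv l (partialDeriv i N) y) (partialDeriv j x y)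
  let B : Matrix (Fin n) (Fin n) ℝ := Matrix.of fun i j =>
    inner ℝ (partialDeriv l (partialDeriv i x) y) (partialDeriv j x y)
  let C : Matrix (Fin n) (Fin n) ℝ := Matrix.of fun i j =>
    inner ℝ (partialDeriv j N y) (partialDeriv l (partialDeriv i x) y)
  -- Since ∂ⱼN is tangent, its pairing with ∂ₗ∂ᵢx can be expanded through the frame.
  have hC : C = B * G * h := by
    ext i j
    change inner ℝ (partialDeriv j N y) (partialDeriv l (partialDeriv i x) y) = _
    rw [real_inner_comm, hx.inner_eq_sum_of_orthogonal hy (hx.inner_normal_partial_normal hy j),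
      Matrix.mul_apply, Finset.sum_comm]
    refine Finset.sum_congr rfl fun b _ => ?_
    rw [Matrix.mul_apply, Finset.sum_mul]
    refine Finset.sum_congr rfl fun a _ => ?_
    have h1 : h b j = inner ℝ (partialDeriv b x y) (partialDeriv j N y) := by
      rw [real_inner_comm]; exact hx.secondAt_symm hy b j
    rw [h1]
    change _ = inner ℝ (partialDeriv l (partialDeriv i x) y) (partialDeriv a x y) * G a b * _
    ring
  have hline := hasDerivAt_comp_line ((hx.contDiffAt_meanAt hy).differentiableAt (by simp)) l
  have hgram : ∀ i j, HasDerivWithinAt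
      (fun r : ℝ => gramAt x (y + r • EuclideanSpace.single l (1 : ℝ)) i j)
      ((B + B.transpose) i j) Set.univ 0 := by
    intro i j
    have h1 := hasDerivAt_comp_line (f := fun z => gramAt x z i j)
      ((hx.diff_partial hy i).inner ℝ (hx.diff_partial hy j)) l
    refine h1.hasDerivWithinAt.congr_deriv ?_
    refine (partialDeriv_inner (hx.diff_partial hy i) (hx.diff_partial hy j) l).trans ?_
    rw [add_comm, real_inner_comm _ (partialDeriv i x y)]
    rfl
  have hsecond : ∀ i j, HasDerivWithinAt
      (fun r : ℝ => secondAt x N (y + r • EuclideanSpace.single l (1 : ℝ)) i j)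
      ((A + C.transpose) i j) Set.univ 0 := by
    intro i j
    have h1 := hasDerivAt_comp_line (f := fun z => secondAt x N z i j)
      ((hx.diff_partial_normal hy i).inner ℝ (hx.diff_partial hy j)) l
    refine h1.hasDerivWithinAt.congr_deriv ?_
    refine (partialDeriv_inner (hx.diff_partial_normal hy i) (hx.diff_partial hy j) l).trans ?_
    rw [add_comm]
    rfl
  have hd := hasDerivWithinAt_trace_inv_mul hgram hsecond (by simpa using hx.det_ne_zero hy)
  rw [hasDerivWithinAt_univ] at hd
  have hval := hline.unique hd
  simp only [zero_smul, add_zero, ← hG, ← hh] at hval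
  have hGt : G.transpose = G := gramAt_inv_transpose
  have hht : h.transpose = h := hx.secondAt_transpose hy
  -- The traces below coincide by transposing and permuting cyclically, as G and h are symmetric.
  have h1 : (G * C.transpose).trace = (G * C).trace := by
    rw [← Matrix.trace_transpose (G * C.transpose), Matrix.transpose_mul, Matrix.transpose_transpose,
      hGt, Matrix.trace_mul_comm]
  have h2 : (G * B.transpose * G * h).trace = (G * C).trace := by
    rw [← Matrix.trace_transpose, Matrix.transpose_mul, Matrix.transpose_mul, Matrix.transpose_mul,
      Matrix.transpose_transpose, hGt, hht, hC, Matrix.trace_mul_comm h]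
    simp only [Matrix.mul_assoc]
  have h3 : (G * B * G * h).trace = (G * C).trace := by
    rw [hC]; simp only [Matrix.mul_assoc]
  have h4 : partialDeriv l (meanAt x N) y = (G * (A - C)).trace := by
    rw [hval, Matrix.mul_add, Matrix.mul_add, Matrix.add_mul, Matrix.add_mul, Matrix.trace_add,
      Matrix.trace_add, h1, h2, h3, Matrix.mul_sub, Matrix.trace_sub]
    ring
  rw [h4, trace_mul_eq_sum, Finset.sum_comm]
  refine Finset.sum_congr rfl fun i _ => Finset.sum_congr rfl fun j _ => ?_
  rw [hG, gramAt_inv_symm]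
  rfl

/-- The Codazzi equation ∇ᵢhⱼₗ = ∇ₗhᵢⱼ, with Christoffel terms already absorbed by
`sum_gammaAt_mul_inner`. In flat space it reduces to differentiating hⱼₗ = hₗⱼ and commuting partial
derivatives. -/
theorem codazzi (hx : IsHypersurface V x N) (hy : y ∈ V) (i j l : Fin n) :
    (inner ℝ (partialDeriv l x y) (partialDeriv i (partialDeriv j N) y) : ℝ) -
        inner ℝ (partialDeriv l N y) (partialDeriv i (partialDeriv j x) y) =
      inner ℝ (partialDeriv l (partialDeriv i N) y) (partialDeriv j x y) -
        inner ℝ (partialDeriv j N y) (partialDeriv l (partialDeriv i x) y) := by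
  have h1 := partialDeriv_congr hx.isOpen (fun z hz => hx.secondAt_symm hz j l) hy i
  rw [partialDeriv_inner (hx.diff_partial_normal hy _) (hx.diff_partial hy _),
    partialDeriv_inner (hx.diff_partial_normal hy _) (hx.diff_partial hy _),
    partialDeriv_comm hx.smooth hx.isOpen hy i l,
    partialDeriv_comm hx.smooth_normal hx.isOpen hy i l] at h1
  rw [real_inner_comm _ (partialDeriv l x y)]
  linarith

theorem sum_inner_partial_normal (hx : IsHypersurface V x N) (hy : y ∈ V) :
    ∑ i, ∑ j, (gramAt x y)⁻¹ i j * inner ℝ (partialDeriv i N y) (partialDeriv j N y) =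
      normSqAt x N y := by
  have h1 : ∀ i j, inner ℝ (partialDeriv i N y) (partialDeriv j N y) =
      (secondAt x N y * (gramAt x y)⁻¹ * secondAt x N y) j i := by
    intro i j
    rw [real_inner_comm, hx.inner_eq_sum_of_orthogonal hy (hx.inner_normal_partial_normal hy i),
      Matrix.mul_apply, Finset.sum_comm]
    refine Finset.sum_congr rfl fun b _ => ?_
    rw [Matrix.mul_apply, Finset.sum_mul]
    refine Finset.sum_congr rfl fun a _ => ?_
    have h2 : secondAt x N y b i = inner ℝ (partialDeriv b x y) (partialDeriv i N y) := by
      rw [real_inner_comm]; exact hx.secondAt_symm hy b i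
    rw [h2]
    change _ = inner ℝ (partialDeriv j N y) (partialDeriv a x y) * (gramAt x y)⁻¹ a b * _
    ring
  simp only [h1]
  rw [← trace_mul_eq_sum, normSqAt]
  simp only [Matrix.mul_assoc]

theorem partialDeriv_support (hx : IsHypersurface V x N) (hy : y ∈ V) (j : Fin n) :
    partialDeriv j (fun z => (inner ℝ (x z) (N z) : ℝ)) y = inner ℝ (x y) (partialDeriv j N y) := by
  rw [partialDeriv_inner (hx.diff hy) (hx.diff_normal hy), real_inner_comm (N y),
    hx.orthogonal y hy, add_zero]

/-- As ∂ⱼ⟨x, N⟩ = ⟨x, ∂ⱼN⟩, one more derivative gives Δ⟨x, N⟩ = ⟨x, ΔN⟩ + H; then ΔN = ∇H - |A|²N is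
inserted. -/
theorem laplaceAt_support (hx : IsHypersurface V x N) (hy : y ∈ V) :
    laplaceAt x (fun z => inner ℝ (x z) (N z)) y =
      ∑ k, ∑ l, (gramAt x y)⁻¹ k l * inner ℝ (x y) (partialDeriv k x y) *
        partialDeriv l (meanAt x N) y + meanAt x N y - normSqAt x N y * inner ℝ (x y) (N y) := by
  -- w is ΔN, taken componentwise; it is determined by pairing with N and with each ∂ₗx.
  set w : EuclideanSpace ℝ (Fin (n + 1)) := ∑ i, ∑ j, (gramAt x y)⁻¹ i j •
    (partialDeriv i (partialDeriv j N) y - ∑ k, gammaAt x y k i j • partialDeriv k N y) with hw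
  have hin : ∀ v, inner ℝ v w = ∑ i, ∑ j, (gramAt x y)⁻¹ i j *
      (inner ℝ v (partialDeriv i (partialDeriv j N) y) -
        ∑ k, gammaAt x y k i j * inner ℝ v (partialDeriv k N y)) := by
    intro v
    simp only [hw, inner_sum, inner_smul_right, inner_sub_right]
  have hwN : inner ℝ (N y) w = -normSqAt x N y := by
    rw [hin, ← hx.sum_inner_partial_normal hy, ← Finset.sum_neg_distrib]
    refine Finset.sum_congr rfl fun i _ => ?_
    rw [← Finset.sum_neg_distrib]
    refine Finset.sum_congr rfl fun j _ => ?_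
    simp [hx.inner_normal_partial_partial_normal hy, hx.inner_normal_partial_normal hy]
  -- Codazzi turns the divergence of h into the derivative of its trace.
  have hwX : ∀ l, inner ℝ (partialDeriv l x y) w = partialDeriv l (meanAt x N) y := by
    intro l
    rw [hin, hx.partialDeriv_meanAt hy]
    refine Finset.sum_congr rfl fun i _ => Finset.sum_congr rfl fun j _ => ?_
    have h1 : ∀ k, inner ℝ (partialDeriv l x y) (partialDeriv k N y) =
        inner ℝ (partialDeriv l N y) (partialDeriv k x y) := fun k => by
      rw [real_inner_comm, hx.secondAt_symm hy]
    simp only [h1]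
    rw [hx.sum_gammaAt_mul_inner hy (hx.inner_normal_partial_normal hy l), hx.codazzi hy]
  have hxw := hx.inner_eq_sum hy (x y) w
  simp only [hwN, hwX] at hxw
  have hess : ∀ i j, hessAt x (fun z => inner ℝ (x z) (N z)) y i j =
      (inner ℝ (x y) (partialDeriv i (partialDeriv j N) y) -
        ∑ k, gammaAt x y k i j * inner ℝ (x y) (partialDeriv k N y)) + secondAt x N y j i := by
    intro i j
    rw [hessAt, partialDeriv_congr hx.isOpen (fun z hz => hx.partialDeriv_support hz j) hy,
      partialDeriv_inner (hx.diff hy) (hx.diff_partial_normal hy j)]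
    simp only [hx.partialDeriv_support hy]
    rw [real_inner_comm (partialDeriv j N y)]
    change _ = _ + inner ℝ (partialDeriv j N y) (partialDeriv i x y)
    ring
  rw [laplaceAt]
  simp only [hess, mul_add, Finset.sum_add_distrib]
  rw [← hin, ← trace_mul_eq_sum, hxw, meanAt]
  ring

end IsHypersurface

end PhiFlow

/-! ### Product rule for the Laplacian and evolution equations in a parametrization. -/

namespace PhiFlow

variable {n : ℕ} {V : Set (EuclideanSpace ℝ (Fin n))}

section operators
variable {x : EuclideanSpace ℝ (Fin n) → EuclideanSpace ℝ (Fin (n + 1))}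
  {f u : EuclideanSpace ℝ (Fin n) → ℝ} {y : EuclideanSpace ℝ (Fin n)}

theorem laplaceAt_congr (hV : IsOpen V) (h : ∀ z ∈ V, f z = u z) (hy : y ∈ V) :
    laplaceAt x f y = laplaceAt x u y := by
  have h1 : ∀ i, ∀ z ∈ V, partialDeriv i f z = partialDeriv i u z := fun i z hz =>
    partialDeriv_congr hV h hz i
  simp only [laplaceAt, hessAt, h1 _ y hy]
  refine Finset.sum_congr rfl fun i _ => Finset.sum_congr rfl fun j _ => ?_
  rw [partialDeriv_congr hV (h1 j) hy]

theorem partialDeriv_sub_const (c : ℝ) (i : Fin n) :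
    partialDeriv i (fun z => f z - c) = partialDeriv i f := by
  ext z
  rw [partialDeriv, fderiv_sub_const, partialDeriv]

theorem laplaceAt_sub_const (c : ℝ) : laplaceAt x (fun z => f z - c) y = laplaceAt x f y := by
  simp only [laplaceAt, hessAt, partialDeriv_sub_const]

theorem gradInnerAt_sub_const (c : ℝ) :
    gradInnerAt x f (fun z => u z - c) y = gradInnerAt x f u y := by
  simp only [gradInnerAt, partialDeriv_sub_const]

/-- The Christoffel part of the Hessian is first order and obeys Leibniz; only the second partials
leave cross terms, and these two agree after contraction with the symmetric inverse metric. -/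
theorem laplaceAt_mul (hV : IsOpen V) (hf : ContDiffOn ℝ ∞ f V) (hu : ContDiffOn ℝ ∞ u V)
    (hy : y ∈ V) : laplaceAt x (fun z => f z * u z) y =
      f y * laplaceAt x u y + u y * laplaceAt x f y + 2 * gradInnerAt x f u y := by
  have hfd : ∀ z ∈ V, DifferentiableAt ℝ f z := fun z hz => hf.differentiableAt_of_isOpen hV hz
  have hud : ∀ z ∈ V, DifferentiableAt ℝ u z := fun z hz => hu.differentiableAt_of_isOpen hV hz
  have hpf : ∀ i, DifferentiableAt ℝ (partialDeriv i f) y := fun i =>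
    (contDiffOn_partialDeriv hf hV i).differentiableAt_of_isOpen hV hy
  have hpu : ∀ i, DifferentiableAt ℝ (partialDeriv i u) y := fun i =>
    (contDiffOn_partialDeriv hu hV i).differentiableAt_of_isOpen hV hy
  have h1 : ∀ i, ∀ z ∈ V, partialDeriv i (fun z => f z * u z) z =
      f z * partialDeriv i u z + partialDeriv i f z * u z := fun i z hz =>
    partialDeriv_mul (hfd z hz) (hud z hz) i
  have hess : ∀ i j, hessAt x (fun z => f z * u z) y i j = f y * hessAt x u y i j +
      u y * hessAt x f y i j + (partialDeriv i f y * partialDeriv j u y +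
        partialDeriv j f y * partialDeriv i u y) := by
    intro i j
    have hs : ∑ k, gammaAt x y k i j *
        (f y * partialDeriv k u y + partialDeriv k f y * u y) =
        f y * ∑ k, gammaAt x y k i j * partialDeriv k u y +
          u y * ∑ k, gammaAt x y k i j * partialDeriv k f y := by
      rw [Finset.mul_sum, Finset.mul_sum, ← Finset.sum_add_distrib]
      exact Finset.sum_congr rfl fun k _ => by ring
    simp only [hessAt, h1 _ y hy, hs]
    rw [partialDeriv_congr hV (h1 j) hy,
      partialDeriv_add ((hfd y hy).fun_mul (hpu j)) ((hpf j).fun_mul (hud y hy)),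
      partialDeriv_mul (hfd y hy) (hpu j), partialDeriv_mul (hpf j) (hud y hy)]
    ring
  have hswap : ∑ i, ∑ j, (gramAt x y)⁻¹ i j * (partialDeriv j f y * partialDeriv i u y) =
      gradInnerAt x f u y := by
    rw [Finset.sum_comm]
    refine Finset.sum_congr rfl fun i _ => Finset.sum_congr rfl fun j _ => ?_
    rw [gramAt_inv_symm]; ring
  have hdir : ∑ i, ∑ j, (gramAt x y)⁻¹ i j * (partialDeriv i f y * partialDeriv j u y) =
      gradInnerAt x f u y :=
    Finset.sum_congr rfl fun i _ => Finset.sum_congr rfl fun j _ => by ring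
  simp only [laplaceAt, hess, mul_add, Finset.sum_add_distrib, hswap, hdir, Finset.mul_sum]
  have : ∀ (c : ℝ) (k : EuclideanSpace ℝ (Fin n) → ℝ) (i j : Fin n),
      (gramAt x y)⁻¹ i j * (c * hessAt x k y i j) = c * ((gramAt x y)⁻¹ i j * hessAt x k y i j) :=
    fun _ _ _ _ => by ring
  simp only [this]
  ring

end operators

section evolution
variable {T : ℝ} {x N : ℝ → EuclideanSpace ℝ (Fin n) → EuclideanSpace ℝ (Fin (n + 1))} {t : ℝ}

/-- The evolution equations of the mean curvature and of the support function under a normal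
variation with speed `-F`. -/
theorem hasDerivWithinAt_meanAt_and_support
    (hxs : ContDiffOn ℝ ∞ (fun z : ℝ × EuclideanSpace ℝ (Fin n) => x z.1 z.2)
      (Set.Ico 0 T ×ˢ V))
    (hNs : ContDiffOn ℝ ∞ (fun z : ℝ × EuclideanSpace ℝ (Fin n) => N z.1 z.2)
      (Set.Ico 0 T ×ˢ V))
    (hx : ∀ s ∈ Set.Ico 0 T, IsHypersurface V (x s) (N s)) (ht : t ∈ Set.Ico 0 T)
    {F : EuclideanSpace ℝ (Fin n) → ℝ} (hF : ContDiffOn ℝ ∞ F V)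
    (hev : ∀ y ∈ V, HasDerivWithinAt (fun s => x s y) (-(F y • N t y)) (Set.Ico 0 T) t)
    {y : EuclideanSpace ℝ (Fin n)} (hy : y ∈ V) :
    HasDerivWithinAt (fun s => meanAt (x s) (N s) y)
      (laplaceAt (x t) F y + F y * normSqAt (x t) (N t) y) (Set.Ico 0 T) t ∧
    HasDerivWithinAt (fun s => (inner ℝ (x s y) (N s y) : ℝ))
      (-F y + ∑ k, ∑ l, (gramAt (x t) y)⁻¹ k l * inner ℝ (x t y) (partialDeriv k (x t) y) *
        partialDeriv l F y) (Set.Ico 0 T) t := by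
  have hV : IsOpen V := (hx t ht).isOpen
  have hu : UniqueDiffWithinAt ℝ (Set.Ico 0 T) t := uniqueDiffOn_Ico 0 T t ht
  have hxt := hx t ht
  obtain ⟨x', -, hx', hpx⟩ := exists_time_derivative hV hxs ht
  obtain ⟨P, hP, hNt, hpN⟩ := exists_time_derivative hV hNs ht
  have hFd : ∀ z ∈ V, DifferentiableAt ℝ F z := fun z hz => hF.differentiableAt_of_isOpen hV hz
  -- Derivatives within the time interval are unique, so the abstract time derivative is the given
  -- velocity on all of V and can be differentiated in space.
  have hx'eq : ∀ z ∈ V, x' z = (-F z) • N t z := fun z hz => by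
    rw [neg_smul]; exact hu.eq_deriv _ (hx' z hz) (hev z hz)
  have hdx' : ∀ z ∈ V, ∀ i, partialDeriv i x' z =
      -(F z • partialDeriv i (N t) z + partialDeriv i F z • N t z) := by
    intro z hz i
    have hneg : partialDeriv i (fun z => -F z) z = -partialDeriv i F z := by
      simp [partialDeriv, fderiv_fun_neg]
    rw [partialDeriv_congr hV hx'eq hz, partialDeriv_smul (hFd z hz).fun_neg (hxt.diff_normal hz), hneg,
      neg_smul, neg_smul, neg_add]
  have hpx' : ∀ z ∈ V, ∀ i, HasDerivWithinAt (fun s => partialDeriv i (x s) z)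
      (-(F z • partialDeriv i (N t) z + partialDeriv i F z • N t z)) (Set.Ico 0 T) t :=
    fun z hz i => by
      have := hpx z hz (EuclideanSpace.single i 1)
      rwa [← partialDeriv, hdx' z hz] at this
  have hNN : ∀ z ∈ V, inner ℝ (N t z) (N t z) = 1 := fun z hz => by
    rw [real_inner_self_eq_norm_sq, hxt.norm_normal z hz, one_pow]
  have hPN : inner ℝ (N t y) (P y) = 0 := by
    have h1 := (hNt y hy).inner ℝ (hNt y hy)
    have h2 : HasDerivWithinAt (fun s => (inner ℝ (N s y) (N s y) : ℝ)) 0 (Set.Ico 0 T) t :=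
      (hasDerivWithinAt_const t _ (1 : ℝ)).congr_of_mem (fun s hs => by
        rw [real_inner_self_eq_norm_sq, (hx s hs).norm_normal y hy, one_pow]) ht
    have h3 := hu.eq_deriv _ h1 h2
    linarith [real_inner_comm (N t y) (P y)]
  -- Differentiating ⟨N, ∂ⱼx⟩ = 0 in time; since P = ∂ₜN is also orthogonal to N, this says ∂ₜN =
  -- ∇F.
  have hPX : ∀ z ∈ V, ∀ j, inner ℝ (P z) (partialDeriv j (x t) z) = partialDeriv j F z := by
    intro z hz j
    have h1 := (hNt z hz).inner ℝ (hpx' z hz j)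
    have h2 : HasDerivWithinAt (fun s => (inner ℝ (N s z) (partialDeriv j (x s) z) : ℝ)) 0
        (Set.Ico 0 T) t :=
      (hasDerivWithinAt_const t _ (0 : ℝ)).congr_of_mem
        (fun s hs => (hx s hs).orthogonal z hz j) ht
    have h3 := hu.eq_deriv _ h1 h2
    simp only [inner_neg_right, inner_add_right, inner_smul_right, hNN z hz,
      hxt.inner_normal_partial_normal hz] at h3
    linarith
  constructor
  -- The metric evolves by ∂ₜg = -2Fh.
  · have hgram : ∀ i j, HasDerivWithinAt (fun s => gramAt (x s) y i j)
        (((-2 * F y) • secondAt (x t) (N t) y) i j) (Set.Ico 0 T) t := by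
      intro i j
      refine ((hpx' y hy i).inner ℝ (hpx' y hy j)).congr_deriv ?_
      simp only [inner_neg_right, inner_neg_left, inner_add_right, inner_add_left,
        inner_smul_right, inner_smul_left, hxt.orthogonal y hy j,
        real_inner_comm (N t y) (partialDeriv i (x t) y), hxt.orthogonal y hy i,
        real_inner_comm (partialDeriv j (N t) y) (partialDeriv i (x t) y),
        hxt.secondAt_symm hy j i, Matrix.smul_apply, secondAt, Matrix.of_apply, smul_eq_mul,
        conj_trivial]
      ring
    have hsecond : ∀ i j, HasDerivWithinAt (fun s => secondAt (x s) (N s) y i j)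
        ((Matrix.of fun i j => hessAt (x t) F y i j -
          F y * inner ℝ (partialDeriv i (N t) y) (partialDeriv j (N t) y)) i j)
        (Set.Ico 0 T) t := by
      intro i j
      refine ((hpN y hy (EuclideanSpace.single i 1)).inner ℝ (hpx' y hy j)).congr_deriv ?_
      -- Differentiating ⟨P, ∂ⱼx⟩ = ∂ⱼF yields ⟨∂ᵢP, ∂ⱼx⟩; the leftover ⟨P, ∂ᵢ∂ⱼx⟩ is exactly the
      -- Christoffel term of the Hessian of F.
      have h1 := partialDeriv_congr hV (fun z hz => hPX z hz j) hy i
      rw [partialDeriv_inner (hP.differentiableAt_of_isOpen hV hy) (hxt.diff_partial hy j),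
        ← hxt.sum_gammaAt_mul_inner hy hPN] at h1
      simp only [hPX y hy] at h1
      rw [← partialDeriv, ← partialDeriv, Matrix.of_apply, hessAt, ← h1]
      simp only [inner_neg_right, inner_add_right, inner_smul_right,
        real_inner_comm (N t y) (partialDeriv i (N t) y), hxt.inner_normal_partial_normal hy]
      ring
    refine (hasDerivWithinAt_trace_inv_mul hgram hsecond (hxt.det_ne_zero hy)).congr_deriv ?_
    -- The inverse metric contributes +2F|A|² and the second form -F|A|², leaving +F|A|².
    have h1 : ((gramAt (x t) y)⁻¹ * (-2 * F y) • secondAt (x t) (N t) y * (gramAt (x t) y)⁻¹ *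
        secondAt (x t) (N t) y).trace = (-2 * F y) * normSqAt (x t) (N t) y := by
      simp only [normSqAt, Matrix.mul_smul, Matrix.smul_mul, Matrix.trace_smul, smul_eq_mul,
        Matrix.mul_assoc]
    have h2 : ((gramAt (x t) y)⁻¹ * Matrix.of fun i j => hessAt (x t) F y i j -
          F y * inner ℝ (partialDeriv i (N t) y) (partialDeriv j (N t) y)).trace =
        laplaceAt (x t) F y - F y * normSqAt (x t) (N t) y := by
      rw [trace_mul_eq_sum, Finset.sum_comm, laplaceAt, ← hxt.sum_inner_partial_normal hy,
        Finset.mul_sum, ← Finset.sum_sub_distrib]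
      refine Finset.sum_congr rfl fun i _ => ?_
      rw [Finset.mul_sum, ← Finset.sum_sub_distrib]
      refine Finset.sum_congr rfl fun j _ => ?_
      rw [gramAt_inv_symm, Matrix.of_apply]
      ring
    rw [h1, h2]
    ring
  · refine ((hev y hy).inner ℝ (hNt y hy)).congr_deriv ?_
    have h1 := hxt.inner_eq_sum_of_orthogonal hy (v := x t y) hPN
    simp only [real_inner_comm (P y), hPX y hy] at h1
    rw [real_inner_comm, h1, inner_neg_left, inner_smul_left, hNN y hy, conj_trivial]
    ring

theorem partialDeriv_comp {Φ : ℝ → ℝ} {f : EuclideanSpace ℝ (Fin n) → ℝ}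
    {y : EuclideanSpace ℝ (Fin n)} (hΦ : DifferentiableAt ℝ Φ (f y)) (hf : DifferentiableAt ℝ f y)
    (i : Fin n) : partialDeriv i (fun z => Φ (f z)) y = deriv Φ (f y) * partialDeriv i f y := by
  have := (hΦ.hasDerivAt.comp_hasFDerivAt y hf.hasFDerivAt).fderiv
  change fderiv ℝ (Φ ∘ f) y _ = _
  rw [this]
  simp [partialDeriv]

/-- The evolution equation of `Φ(H) / (⟨x, N⟩ - ε)` for a parametrized hypersurface. -/
theorem hasDerivWithinAt_quotient {Φ : ℝ → ℝ} {U : Set ℝ} (hU : IsOpen U)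
    (hΦ : ContDiffOn ℝ ∞ Φ U)
    (hxs : ContDiffOn ℝ ∞ (fun z : ℝ × EuclideanSpace ℝ (Fin n) => x z.1 z.2)
      (Set.Ico 0 T ×ˢ V))
    (hNs : ContDiffOn ℝ ∞ (fun z : ℝ × EuclideanSpace ℝ (Fin n) => N z.1 z.2)
      (Set.Ico 0 T ×ˢ V))
    (hx : ∀ s ∈ Set.Ico 0 T, IsHypersurface V (x s) (N s)) (ht : t ∈ Set.Ico 0 T)
    (hmem : ∀ y ∈ V, meanAt (x t) (N t) y ∈ U)
    (hev : ∀ y ∈ V, HasDerivWithinAt (fun s => x s y)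
      (-(Φ (meanAt (x t) (N t) y) • N t y)) (Set.Ico 0 T) t)
    {y : EuclideanSpace ℝ (Fin n)} (hy : y ∈ V) {ε : ℝ} (hden : inner ℝ (x t y) (N t y) ≠ ε)
    (hspeed : Φ (meanAt (x t) (N t) y) ≠ 0) :
    let H : ℝ := meanAt (x t) (N t) y
    let S : EuclideanSpace ℝ (Fin n) → ℝ := fun z => inner ℝ (x t z) (N t z)
    let Z : ℝ → EuclideanSpace ℝ (Fin n) → ℝ := fun s z =>
      Φ (meanAt (x s) (N s) z) / (inner ℝ (x s z) (N s z) - ε)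
    ContDiffAt ℝ ∞ (Z t) y ∧
    HasDerivWithinAt (fun s => Z s y)
      (deriv Φ H * laplaceAt (x t) (Z t) y
        + 2 * deriv Φ H / (S y - ε) * gradInnerAt (x t) (Z t) S y
        + Z t y ^ 2 * ((deriv Φ H * H / Φ H + 1)
          - ε * (deriv Φ H * normSqAt (x t) (N t) y / Φ H))) (Set.Ico 0 T) t := by
  intro H S Z
  have hxt := hx t ht
  have hV := hxt.isOpen
  set h : EuclideanSpace ℝ (Fin n) → ℝ := meanAt (x t) (N t) with hh
  set F : EuclideanSpace ℝ (Fin n) → ℝ := fun z => Φ (h z) with hFdef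
  have hhs : ContDiffOn ℝ ∞ h V := fun z hz => (hxt.contDiffAt_meanAt hz).contDiffWithinAt
  have hF : ContDiffOn ℝ ∞ F V := hΦ.comp hhs hmem
  have hS : ContDiffOn ℝ ∞ S V := hxt.smooth.inner ℝ hxt.smooth_normal
  obtain ⟨hHt, hSt⟩ := hasDerivWithinAt_meanAt_and_support hxs hNs hx ht hF hev hy
  have hΦd : DifferentiableAt ℝ Φ H :=
    (hΦ.contDiffAt (hU.mem_nhds (hmem y hy))).differentiableAt (by simp)
  have hFt : HasDerivWithinAt (fun s => Φ (meanAt (x s) (N s) y)) _ (Set.Ico 0 T) t :=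
    hΦd.hasDerivAt.comp_hasDerivWithinAt t hHt
  have hne : S y - ε ≠ 0 := sub_ne_zero.2 hden
  -- The denominator is nonzero on a whole neighbourhood of y, as needed for second derivatives of
  -- Z.
  let V' : Set (EuclideanSpace ℝ (Fin n)) := V ∩ (fun z => S z - ε) ⁻¹' {0}ᶜ
  have hV' : IsOpen V' :=
    (hS.continuousOn.sub continuousOn_const).isOpen_inter_preimage hV isOpen_compl_singleton
  have hy' : y ∈ V' := ⟨hy, hne⟩
  have hu' : ContDiffOn ℝ ∞ (fun z => S z - ε) V' :=
    (hS.mono Set.inter_subset_left).sub contDiffOn_const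
  have hZ : ContDiffOn ℝ ∞ (Z t) V' :=
    (hF.mono Set.inter_subset_left).div hu' fun z hz => hz.2
  -- Applying the Laplacian to this product avoids second derivatives of a quotient.
  have hZu : ∀ z ∈ V', F z = Z t z * (S z - ε) := fun z hz => (div_mul_cancel₀ _ hz.2).symm
  have hlap := laplaceAt_congr (x := x t) hV' hZu hy'
  rw [laplaceAt_mul hV' hZ hu' hy', laplaceAt_sub_const, gradInnerAt_sub_const,
    hxt.laplaceAt_support hy] at hlap
  have hdF : ∀ l, partialDeriv l F y = deriv Φ H * partialDeriv l h y := fun l =>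
    partialDeriv_comp hΦd ((hxt.contDiffAt_meanAt hy).differentiableAt (by simp)) l
  have hsum : ∑ k, ∑ l, (gramAt (x t) y)⁻¹ k l * inner ℝ (x t y) (partialDeriv k (x t) y) *
      partialDeriv l F y = deriv Φ H * ∑ k, ∑ l, (gramAt (x t) y)⁻¹ k l *
        inner ℝ (x t y) (partialDeriv k (x t) y) * partialDeriv l h y := by
    simp only [hdF, Finset.mul_sum]
    exact Finset.sum_congr rfl fun k _ => Finset.sum_congr rfl fun l _ => by ring
  rw [hsum] at hSt
  refine ⟨hZ.contDiffAt (hV'.mem_nhds hy'), (hFt.div (hSt.sub_const ε) hne).congr_deriv ?_⟩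
  rw [hlap]
  have hΦ0 : Φ H ≠ 0 := hspeed
  have hZy : Z t y = Φ H / (S y - ε) := rfl
  have hFy : F y = Φ H := rfl
  have hSy : (inner ℝ (x t y) (N t y) : ℝ) = S y := rfl
  have hHy : meanAt (x t) (N t) y = H := rfl
  rw [hZy, hFy, hHy, hSy]
  -- q is ⟨X^T, ∇H⟩, which enters through both ΔS and ∂ₜS and cancels; the rest is algebra.
  generalize (∑ k, ∑ l, (gramAt (x t) y)⁻¹ k l *
        inner ℝ (x t y) (partialDeriv k (x t) y) * partialDeriv l h y) = q
  generalize S y = σ at *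
  field_simp
  ring

end evolution

end PhiFlow

/-! ### Passage from the manifold to the preferred chart at a point. -/

namespace PhiFlow

variable {n : ℕ} {M : Type*} [TopologicalSpace M] [ChartedSpace (EuclideanSpace ℝ (Fin n)) M]

section chart
variable {W : Type*} [NormedAddCommGroup W] [NormedSpace ℝ W]

/-- The expression of `f` in the preferred chart at `p`. -/
noncomputable def inChart (p : M) (f : M → W) : EuclideanSpace ℝ (Fin n) → W :=
  f ∘ (chartAt (EuclideanSpace ℝ (Fin n)) p).symm

/-- The tangent space at q is modelled through the preferred chart at q, so there the coordinate
derivatives are values of the intrinsic derivative on the standard basis. -/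
theorem pd_self_eq_mfderiv {f : M → W} {q : M}
    (hf : MDifferentiableAt (𝓡 n) 𝓘(ℝ, W) f q) (i : Fin n) :
    pd q i f q = mfderiv (𝓡 n) 𝓘(ℝ, W) f q
      (show TangentSpace (𝓡 n) q from EuclideanSpace.single i (1 : ℝ)) := by
  rw [hf.mfderiv]
  simp [pd, writtenInExtChartAt, mfld_simps]
  rfl

/-- Equality near the base point, rather than only at it, is what permits a second derivative. -/
theorem pd_eventuallyEq (p : M) (j : Fin n) (f : M → W) :
    inChart p (pd p j f) =ᶠ[nhds (chartAt (EuclideanSpace ℝ (Fin n)) p p)]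
      partialDeriv j (inChart p f) := by
  have ht : (chartAt (EuclideanSpace ℝ (Fin n)) p).target ∈
      nhds (chartAt (EuclideanSpace ℝ (Fin n)) p p) :=
    (chartAt (EuclideanSpace ℝ (Fin n)) p).open_target.mem_nhds
      ((chartAt (EuclideanSpace ℝ (Fin n)) p).map_source (mem_chart_source _ p))
  filter_upwards [ht] with y hy
  simp only [inChart, Function.comp_apply, pd,
    (chartAt (EuclideanSpace ℝ (Fin n)) p).right_inv hy, partialDeriv]

theorem pd_pd (p : M) (i j : Fin n) (f : M → W) :
    pd p i (pd p j f) p = partialDeriv i (partialDeriv j (inChart p f))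
      (chartAt (EuclideanSpace ℝ (Fin n)) p p) := by
  change fderiv ℝ (inChart p (pd p j f)) _ _ = _
  rw [(pd_eventuallyEq p j f).fderiv_eq, partialDeriv]

theorem contMDiff_slice {f : ℝ → M → W} {T : ℝ}
    (hf : ContMDiffOn (𝓘(ℝ, ℝ).prod (𝓡 n)) 𝓘(ℝ, W) ∞ (fun z : ℝ × M => f z.1 z.2)
      (Set.Ico 0 T ×ˢ Set.univ)) {s : ℝ} (hs : s ∈ Set.Ico 0 T) :
    ContMDiff (𝓡 n) 𝓘(ℝ, W) ∞ (f s) :=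
  hf.comp_contMDiff (contMDiff_const.prodMk contMDiff_id) fun q =>
    (⟨hs, Set.mem_univ _⟩ : (s, q) ∈ Set.Ico 0 T ×ˢ Set.univ)

end chart

/-- After expanding each ∂ᵢgⱼₗ by the product rule, commuting second partials cancel all but 2⟨∂ₗx,
∂ᵢ∂ⱼx⟩. -/
theorem christoffel_eq {X N : M → EuclideanSpace ℝ (Fin (n + 1))} {p : M}
    (hx : IsHypersurface (chartAt (EuclideanSpace ℝ (Fin n)) p).target (inChart p X) (inChart p N))
    (k i j : Fin n) : christoffel X p p k i j =
      gammaAt (inChart p X) (chartAt (EuclideanSpace ℝ (Fin n)) p p) k i j := by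
  set c := chartAt (EuclideanSpace ℝ (Fin n)) p with hc
  have hy : c p ∈ c.target := c.map_source (mem_chart_source _ p)
  have hm : ∀ i j l : Fin n, pd p i (fun r => metric X p r j l) p =
      inner ℝ (partialDeriv j (inChart p X) (c p))
        (partialDeriv i (partialDeriv l (inChart p X)) (c p)) +
      inner ℝ (partialDeriv l (inChart p X) (c p))
        (partialDeriv i (partialDeriv j (inChart p X)) (c p)) := by
    intro i j l
    rw [real_inner_comm _ (partialDeriv l (inChart p X) (c p)),
      ← partialDeriv_inner (hx.diff_partial hy j) (hx.diff_partial hy l)]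
    change partialDeriv i (inChart p fun r => metric X p r j l) (c p) = _
    refine partialDeriv_congr hx.isOpen (fun z hz => ?_) hy i
    change inner ℝ (fderiv ℝ (inChart p X) (c (c.symm z)) _)
      (fderiv ℝ (inChart p X) (c (c.symm z)) _) = _
    rw [c.right_inv hz]
    rfl
  rw [christoffel, gammaAt, Finset.mul_sum]
  refine Finset.sum_congr rfl fun l _ => ?_
  rw [hm, hm, hm, partialDeriv_comm hx.smooth hx.isOpen hy l i,
    partialDeriv_comm hx.smooth hx.isOpen hy l j, partialDeriv_comm hx.smooth hx.isOpen hy j i]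
  change 1 / 2 * ((gramAt (inChart p X) (c p))⁻¹ k l * _) = _
  ring

theorem laplacian_eq {X N : M → EuclideanSpace ℝ (Fin (n + 1))} {p : M}
    (hx : IsHypersurface (chartAt (EuclideanSpace ℝ (Fin n)) p).target (inChart p X) (inChart p N))
    (f : M → ℝ) : laplacian X f p =
      laplaceAt (inChart p X) (inChart p f) (chartAt (EuclideanSpace ℝ (Fin n)) p p) := by
  simp only [laplacian, laplaceAt, hessAt, pd_pd, christoffel_eq hx]
  rfl

section invariance
variable [IsManifold (𝓡 n) ∞ M] {W : Type*} [NormedAddCommGroup W] [NormedSpace ℝ W]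

theorem fderiv_inChart {p : M} {y : EuclideanSpace ℝ (Fin n)}
    (hy : y ∈ (chartAt (EuclideanSpace ℝ (Fin n)) p).target) {f : M → W}
    (hf : MDifferentiableAt (𝓡 n) 𝓘(ℝ, W) f ((chartAt (EuclideanSpace ℝ (Fin n)) p).symm y))
    (v : EuclideanSpace ℝ (Fin n)) : fderiv ℝ (inChart p f) y v =
      mfderiv (𝓡 n) 𝓘(ℝ, W) f ((chartAt (EuclideanSpace ℝ (Fin n)) p).symm y)
        (mfderiv (𝓡 n) (𝓡 n) (chartAt (EuclideanSpace ℝ (Fin n)) p).symm y v) := by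
  have : IsManifold (𝓡 n) 1 M := IsManifold.of_le (n := ∞) (by simp)
  have hc : MDifferentiableAt (𝓡 n) (𝓡 n) (chartAt (EuclideanSpace ℝ (Fin n)) p).symm y :=
    (mdifferentiable_chart (I := 𝓡 n) p).mdifferentiableAt_symm hy
  rw [← mfderiv_eq_fderiv, inChart, mfderiv_comp y hf hc]
  rfl

theorem mfderiv_chart_symm_injective {p : M} {y : EuclideanSpace ℝ (Fin n)}
    (hy : y ∈ (chartAt (EuclideanSpace ℝ (Fin n)) p).target) : Function.Injective
      (mfderiv (𝓡 n) (𝓡 n) (chartAt (EuclideanSpace ℝ (Fin n)) p).symm y) := by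
  have : IsManifold (𝓡 n) 1 M := IsManifold.of_le (n := ∞) (by simp)
  exact (mdifferentiable_chart (I := 𝓡 n) p).symm.mfderiv_injective hy

/-- The mean curvature does not depend on the chart. -/
theorem meanAt_inChart {X N : M → EuclideanSpace ℝ (Fin (n + 1))} {p : M}
    (hx : IsHypersurface (chartAt (EuclideanSpace ℝ (Fin n)) p).target (inChart p X) (inChart p N))
    {y : EuclideanSpace ℝ (Fin n)} (hy : y ∈ (chartAt (EuclideanSpace ℝ (Fin n)) p).target)
    (hX : MDifferentiableAt (𝓡 n) 𝓘(ℝ, EuclideanSpace ℝ (Fin (n + 1))) X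
      ((chartAt (EuclideanSpace ℝ (Fin n)) p).symm y))
    (hN : MDifferentiableAt (𝓡 n) 𝓘(ℝ, EuclideanSpace ℝ (Fin (n + 1))) N
      ((chartAt (EuclideanSpace ℝ (Fin n)) p).symm y)) :
    meanAt (inChart p X) (inChart p N) y =
      meanCurvature X N ((chartAt (EuclideanSpace ℝ (Fin n)) p).symm y) := by
  set c := chartAt (EuclideanSpace ℝ (Fin n)) p with hc
  set q := c.symm y with hq
  let e : EuclideanSpace ℝ (Fin n) →L[ℝ] EuclideanSpace ℝ (Fin n) := mfderiv (𝓡 n) (𝓡 n) c.symm y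
  -- J is the Jacobian of the change from the chart at p to the chart at q; g and h both transform
  -- by JᵀgJ and JᵀhJ, so g⁻¹h is conjugated and its trace is unchanged.
  let J : Matrix (Fin n) (Fin n) ℝ := Matrix.of fun k i => e (EuclideanSpace.single i (1 : ℝ)) k
  have hsum : ∀ v : EuclideanSpace ℝ (Fin n), v = ∑ k, v k • EuclideanSpace.single k (1 : ℝ) := by
    intro v
    have := (EuclideanSpace.basisFun (Fin n) ℝ).sum_repr v
    simpa using this.symm
  have hpd : ∀ f : M → EuclideanSpace ℝ (Fin (n + 1)),
      MDifferentiableAt (𝓡 n) 𝓘(ℝ, EuclideanSpace ℝ (Fin (n + 1))) f q → ∀ i,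
      partialDeriv i (inChart p f) y = ∑ k, J k i • pd q k f q := by
    intro f hf i
    let L : EuclideanSpace ℝ (Fin n) →L[ℝ] EuclideanSpace ℝ (Fin (n + 1)) :=
      mfderiv (𝓡 n) 𝓘(ℝ, EuclideanSpace ℝ (Fin (n + 1))) f q
    have h1 : ∀ k, pd q k f q = L (EuclideanSpace.single k (1 : ℝ)) := fun k =>
      pd_self_eq_mfderiv hf k
    have h2 : partialDeriv i (inChart p f) y = L (e (EuclideanSpace.single i (1 : ℝ))) :=
      fderiv_inChart hy hf _
    rw [h2, hsum (e (EuclideanSpace.single i (1 : ℝ))), map_sum]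
    refine Finset.sum_congr rfl fun k _ => ?_
    rw [map_smul, h1]
    rfl
  have hmat : ∀ f k : M → EuclideanSpace ℝ (Fin (n + 1)),
      MDifferentiableAt (𝓡 n) 𝓘(ℝ, EuclideanSpace ℝ (Fin (n + 1))) f q →
      MDifferentiableAt (𝓡 n) 𝓘(ℝ, EuclideanSpace ℝ (Fin (n + 1))) k q →
      (Matrix.of fun i j => (inner ℝ (partialDeriv i (inChart p f) y)
        (partialDeriv j (inChart p k) y) : ℝ)) =
      J.transpose * (Matrix.of fun i j => (inner ℝ (pd q i f q) (pd q j k q) : ℝ)) * J := by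
    intro f k hf hk
    ext i j
    rw [Matrix.of_apply, hpd f hf, hpd k hk, Matrix.mul_apply, inner_sum]
    refine Finset.sum_congr rfl fun b _ => ?_
    rw [Matrix.mul_apply, sum_inner, Finset.sum_mul]
    refine Finset.sum_congr rfl fun a _ => ?_
    rw [inner_smul_left, inner_smul_right, conj_trivial, Matrix.transpose_apply, Matrix.of_apply]
    ring
  have hg : gramAt (inChart p X) y = J.transpose * metric X q q * J := hmat X X hX hX
  have hh : secondAt (inChart p X) (inChart p N) y = J.transpose * secondForm X N q q * J :=
    hmat N X hN hX
  -- Invertibility comes from the nondegenerate Gram matrix in the chart at p, which has det J as a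
  -- factor.
  have hJ : IsUnit J.det := by
    have h1 := hx.det_ne_zero hy
    rw [hg, Matrix.det_mul] at h1
    exact isUnit_iff_ne_zero.2 (right_ne_zero_of_mul h1)
  have hJt : IsUnit J.transpose.det := by rwa [Matrix.det_transpose]
  rw [meanAt, meanCurvature, weingarten, hg, hh, Matrix.mul_inv_rev, Matrix.mul_inv_rev]
  have : J⁻¹ * ((metric X q q)⁻¹ * J.transpose⁻¹) * (J.transpose * secondForm X N q q * J) =
      J⁻¹ * ((metric X q q)⁻¹ * secondForm X N q q * J) := by
    simp only [Matrix.mul_assoc]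
    rw [Matrix.nonsing_inv_mul_cancel_left _ _ hJt]
  rw [this, Matrix.trace_mul_comm, Matrix.mul_assoc, Matrix.mul_nonsing_inv _ hJ, Matrix.mul_one]

end invariance

namespace IsPhiFlow
variable [IsManifold (𝓡 n) ∞ M] {Φ : ℝ → ℝ} {U : Set ℝ} {T : ℝ}
  {X ν : ℝ → M → EuclideanSpace ℝ (Fin (n + 1))}

theorem _root_.PhiFlow.contDiffOn_inChart {W : Type*} [NormedAddCommGroup W] [NormedSpace ℝ W]
    {f : ℝ → M → W}
    (hf : ContMDiffOn (𝓘(ℝ, ℝ).prod (𝓡 n)) 𝓘(ℝ, W) ∞ (fun z : ℝ × M => f z.1 z.2)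
      (Set.Ico 0 T ×ˢ Set.univ)) (p : M) :
    ContDiffOn ℝ ∞ (fun z : ℝ × EuclideanSpace ℝ (Fin n) => inChart p (f z.1) z.2)
      (Set.Ico 0 T ×ˢ (chartAt (EuclideanSpace ℝ (Fin n)) p).target) := by
  have h1 : ContMDiffOn (𝓘(ℝ, ℝ).prod (𝓡 n)) (𝓘(ℝ, ℝ).prod (𝓡 n)) ∞
      (fun z : ℝ × EuclideanSpace ℝ (Fin n) =>
        (z.1, (chartAt (EuclideanSpace ℝ (Fin n)) p).symm z.2))
      (Set.Ico 0 T ×ˢ (chartAt (EuclideanSpace ℝ (Fin n)) p).target) :=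
    contMDiffOn_fst.prodMk
      ((contMDiffOn_chart_symm (I := 𝓡 n) (x := p)).comp contMDiffOn_snd fun z hz => hz.2)
  have h2 := hf.comp h1 fun z hz => (⟨hz.1, Set.mem_univ _⟩ : _ ∈ Set.Ico 0 T ×ˢ Set.univ)
  rw [← contMDiffOn_iff_contDiffOn, modelWithCornersSelf_prod, ← chartedSpaceSelf_prod]
  exact h2

theorem isHypersurface (hX : IsPhiFlow Φ U T X ν) {s : ℝ} (hs : s ∈ Set.Ico 0 T) (p : M) :
    IsHypersurface (chartAt (EuclideanSpace ℝ (Fin n)) p).target (inChart p (X s))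
      (inChart p (ν s)) where
  isOpen := (chartAt (EuclideanSpace ℝ (Fin n)) p).open_target
  smooth := (contDiffOn_inChart hX.smooth_X p).comp (contDiff_prodMk_right s).contDiffOn
    fun y hy => (⟨hs, hy⟩ : (s, y) ∈ Set.Ico 0 T ×ˢ _)
  smooth_normal := (contDiffOn_inChart hX.smooth_normal p).comp
    (contDiff_prodMk_right s).contDiffOn fun y hy => (⟨hs, hy⟩ : (s, y) ∈ Set.Ico 0 T ×ˢ _)
  linearIndependent := by
    intro y hy
    have hinj : Function.Injective (fderiv ℝ (inChart p (X s)) y) := by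
      have h1 : ⇑(fderiv ℝ (inChart p (X s)) y) = _ ∘ _ := funext fun v =>
        fderiv_inChart hy ((contMDiff_slice hX.smooth_X hs).mdifferentiableAt (by simp)) v
      rw [h1]
      exact (hX.immersion s hs _).comp (mfderiv_chart_symm_injective hy)
    have h2 := (EuclideanSpace.basisFun (Fin n) ℝ).toBasis.linearIndependent.map'
      (fderiv ℝ (inChart p (X s)) y).toLinearMap (LinearMap.ker_eq_bot.2 hinj)
    have h3 : (fun i => partialDeriv i (inChart p (X s)) y) =
        (fderiv ℝ (inChart p (X s)) y).toLinearMap ∘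
          (EuclideanSpace.basisFun (Fin n) ℝ).toBasis := by
      ext1 i
      simp [partialDeriv]
    rw [h3]
    exact h2
  norm_normal y _ := hX.norm_normal s hs _
  orthogonal y hy i := by
    rw [partialDeriv, fderiv_inChart hy
      ((contMDiff_slice hX.smooth_X hs).mdifferentiableAt (by simp))]
    exact hX.normal_orthogonal s hs _ _

theorem meanAt_eq (hX : IsPhiFlow Φ U T X ν) {s : ℝ} (hs : s ∈ Set.Ico 0 T) (p : M)
    {y : EuclideanSpace ℝ (Fin n)} (hy : y ∈ (chartAt (EuclideanSpace ℝ (Fin n)) p).target) :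
    meanAt (inChart p (X s)) (inChart p (ν s)) y =
      meanCurvature (X s) (ν s) ((chartAt (EuclideanSpace ℝ (Fin n)) p).symm y) :=
  meanAt_inChart (hX.isHypersurface hs p) hy
    ((contMDiff_slice hX.smooth_X hs).mdifferentiableAt (by simp))
    ((contMDiff_slice hX.smooth_normal hs).mdifferentiableAt (by simp))

end IsPhiFlow

end PhiFlow

/-! ### The evolution equation on the manifold. -/

theorem mainTheorem11 {n : ℕ} (hn : 2 ≤ n) {M : Type*} [TopologicalSpace M] [T2Space M]
    [CompactSpace M] [ChartedSpace (EuclideanSpace ℝ (Fin n)) M] [IsManifold (𝓡 n) ∞ M]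
    (Φ : ℝ → ℝ) (U : Set ℝ) (hU : IsOpen U) (hΦ : ContDiffOn ℝ ∞ Φ U)
    (hΦ' : ∀ x ∈ U, 0 < deriv Φ x) (T : ℝ)
    (X ν : ℝ → M → EuclideanSpace ℝ (Fin (n + 1))) (hX : PhiFlow.IsPhiFlow Φ U T X ν)
    (ε t : ℝ) (ht : t ∈ Set.Ico 0 T) (p : M)
    (hden : PhiFlow.support (X t) (ν t) p ≠ ε)
    (hspeed : Φ (PhiFlow.meanCurvature (X t) (ν t) p) ≠ 0) :
    let H : ℝ := PhiFlow.meanCurvature (X t) (ν t) p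
    let Z : ℝ → M → ℝ := fun s => PhiFlow.quotZ Φ ε (X s) (ν s)
    ContMDiffAt (𝓡 n) 𝓘(ℝ, ℝ) ∞ (Z t) p ∧
    HasDerivWithinAt (fun s => Z s p)
      (deriv Φ H * PhiFlow.laplacian (X t) (Z t) p
        + 2 * deriv Φ H / (PhiFlow.support (X t) (ν t) p - ε)
          * PhiFlow.gradInner (X t) (Z t) (PhiFlow.support (X t) (ν t)) p
        + Z t p ^ 2 * ((deriv Φ H * H / Φ H + 1)
          - ε * (deriv Φ H * PhiFlow.normSqA (X t) (ν t) p / Φ H)))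
      (Set.Ico 0 T) t := by
  intro H Z
  set c := chartAt (EuclideanSpace ℝ (Fin n)) p with hc
  have hp : p ∈ c.source := mem_chart_source _ p
  have hy : c p ∈ c.target := c.map_source hp
  have hcp : c.symm (c p) = p := c.left_inv hp
  -- Z involves H at all points near p, each in its own chart; here everything is brought into the
  -- one chart at p.
  have hmean : ∀ s ∈ Set.Ico 0 T, ∀ y ∈ c.target,
      PhiFlow.meanAt (PhiFlow.inChart p (X s)) (PhiFlow.inChart p (ν s)) y =
        PhiFlow.meanCurvature (X s) (ν s) (c.symm y) := fun s hs y hy => hX.meanAt_eq hs p hy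
  have hH : PhiFlow.meanAt (PhiFlow.inChart p (X t)) (PhiFlow.inChart p (ν t)) (c p) = H := by
    rw [hmean t ht _ hy, hcp]
  have hxp : ∀ s, PhiFlow.inChart p (X s) (c p) = X s p := fun s => congrArg (X s) hcp
  have hνp : ∀ s, PhiFlow.inChart p (ν s) (c p) = ν s p := fun s => congrArg (ν s) hcp
  have main := PhiFlow.hasDerivWithinAt_quotient (x := fun s => PhiFlow.inChart p (X s))
    (N := fun s => PhiFlow.inChart p (ν s)) (ε := ε) hU hΦ
    (PhiFlow.contDiffOn_inChart hX.smooth_X p) (PhiFlow.contDiffOn_inChart hX.smooth_normal p)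
    (fun s hs => hX.isHypersurface hs p) ht
    (fun y hy => by rw [hX.meanAt_eq ht p hy]; exact hX.curvature_mem t ht _)
    (fun y hy => by rw [hX.meanAt_eq ht p hy]; exact hX.evolution t ht _) hy
    (by rw [hxp, hνp]; exact hden) (by rw [hH]; exact hspeed)
  dsimp only at main
  rw [hH, hxp, hνp] at main
  have hZ : ∀ s ∈ Set.Ico 0 T, ∀ y ∈ c.target, PhiFlow.inChart p (Z s) y =
      Φ (PhiFlow.meanAt (PhiFlow.inChart p (X s)) (PhiFlow.inChart p (ν s)) y) /
        (inner ℝ (PhiFlow.inChart p (X s) y) (PhiFlow.inChart p (ν s) y) - ε) := by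
    intro s hs y hy
    rw [hmean s hs y hy]
    rfl
  have hZev := Filter.eventuallyEq_of_mem (c.open_target.mem_nhds hy) (hZ t ht)
  obtain ⟨hsmooth, hderiv⟩ := main
  constructor
  · have h1 : ContMDiffAt (𝓡 n) 𝓘(ℝ, ℝ) ∞ (PhiFlow.inChart p (Z t)) (c p) :=
      (hsmooth.congr_of_eventuallyEq hZev).contMDiffAt
    have h2 : ContMDiffAt (𝓡 n) (𝓡 n) ∞ c p :=
      (contMDiffOn_chart (I := 𝓡 n) (x := p)).contMDiffAt (c.open_source.mem_nhds hp)
    refine (h1.comp p h2).congr_of_eventuallyEq ?_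
    filter_upwards [c.open_source.mem_nhds hp] with q hq
    exact (congrArg (Z t) (c.left_inv hq)).symm
  · have hval : ∀ s ∈ Set.Ico 0 T, Z s p =
        Φ (PhiFlow.meanAt (PhiFlow.inChart p (X s)) (PhiFlow.inChart p (ν s)) (c p)) /
        (inner ℝ (PhiFlow.inChart p (X s) (c p)) (PhiFlow.inChart p (ν s) (c p)) - ε) := by
      intro s hs
      rw [← hZ s hs _ hy]
      exact (congrArg (Z s) hcp).symm
    refine (hderiv.congr hval (hval t ht)).congr_deriv ?_
    have hlap := PhiFlow.laplaceAt_congr (x := PhiFlow.inChart p (X t)) c.open_target (hZ t ht) hy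
    -- The gradient product and |A|² are only needed at p, in the chart at p, so they match their
    -- local versions by definition.
    have hgrad : PhiFlow.gradInner (X t) (Z t) (PhiFlow.support (X t) (ν t)) p =
        PhiFlow.gradInnerAt (PhiFlow.inChart p (X t)) (PhiFlow.inChart p (Z t))
          (fun z => inner ℝ (PhiFlow.inChart p (X t) z) (PhiFlow.inChart p (ν t) z)) (c p) := rfl
    have hpart := fun i => PhiFlow.partialDeriv_congr c.open_target (hZ t ht) hy i
    have hH' : Φ H / (inner ℝ (X t p) (ν t p) - ε) = Z t p := rfl
    have hnorm : PhiFlow.normSqA (X t) (ν t) p = PhiFlow.normSqAt (PhiFlow.inChart p (X t))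
      (PhiFlow.inChart p (ν t)) (c p) := rfl
    rw [PhiFlow.laplacian_eq (hX.isHypersurface ht p), hgrad, hnorm, ← hc, hlap, hH']
    simp only [PhiFlow.gradInnerAt, hpart]
    rfl
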